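/- Let $\mathcal D$ be the Lie algebra of regular differential operators on $\mathbb C[t,t^{-1}]$, with basis $t^kD^l$ ($k\in\mathbb Z$, $l\in\mathbb Z_{\ge 0}$), $D=t\partial_t$. Let $W_{1+\infty}=\mathcal D\oplus\mathbb C C$ be its central extension by the 2-cocycle $\Psi$ for which $\Psi(t^rf(D),t^sg(D))=0$ if $r+s\ne 0$ and $\Psi(t^rf(D),t^{-r}g(D))=\sum_{-r\le m\le -1}f(m)g(m+r)$ if $r\ge 0$. For an integer $n\ge 0$ let $W_\infty^{(n)}=\mathcal D\partial_t^n\oplus\mathbb C C\subset W_{1+\infty}$. These Lie algebras are $\mathbb Z$-graded by $\deg t^kf(D)=k$, $\deg C=0$. For a $\mathbb Z$-graded Lie algebra $\mathfrak g$ and $\lambda\in\mathfrak g_0^*$, let $M(\mathfrak g,\lambda)=U(\mathfrak g)\otimes_{U(\mathfrak g_0\oplus\mathfrak g_+)}\mathbb C_\lambda$ be the Verma module, and let $L(\mathfrak g,\lambda)$ be its quotient by the maximal proper graded submodule; it is called quasifinite if all its graded components are finite-dimensional. **Proposition 4.10.** Let $n\ge 0$ and $\lambda\in (W_\infty^{(n)})_0^*$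 be such that the $W_\infty^{(n)}$-module $L(\lambda)=L(W_\infty^{(n)},\lambda)$ is quasifinite. Then there exists $\tilde\lambda\in (W_{1+\infty})_0^*$ with $\tilde\lambda|_{(W_\infty^{(n)})_0}=\lambda$ such that the $W_{1+\infty}$-module $L(W_{1+\infty},\tilde\lambda)$ is quasifinite and $L(\lambda)$ is a quotient, as a graded $W_\infty^{(n)}$-module, of the $W_\infty^{(n)}$-submodule of $L(W_{1+\infty},\tilde\lambda)$ generated by the highest weight vector, with the highest weight vector of $L(W_{1+\infty},\tilde\lambda)$ mapping to the highest weight vector of $L(\lambda)$. -/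

import Mathlib

open Polynomial

noncomputable section

namespace WInfinity

/-! ### Differential operators on the circle -/

/-- The space `𝒟` of regular differential operators on the circle. An element is a finitely
supported family `(f_r)` of polynomials, and stands for the operator `∑ t ^ r f_r(D)`,
`D = t ∂_t`, on `ℂ[t, t⁻¹]` (see `DiffOp.toEnd`). -/
def DiffOp : Type := ℤ →₀ ℂ[X]

namespace DiffOp

instance : AddCommGroup DiffOp := inferInstanceAs (AddCommGroup (ℤ →₀ ℂ[X]))
instance : Module ℂ DiffOp := inferInstanceAs (Module ℂ (ℤ →₀ ℂ[X]))

/-- The linear map sending the polynomial `f` to the operator `t ^ r f(D)`. -/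
def mono (r : ℤ) : ℂ[X] →ₗ[ℂ] DiffOp := Finsupp.lsingle r

/-- The linear map sending an operator `∑ t ^ r f_r(D)` to the polynomial `f_r`. -/
def coeff (r : ℤ) : DiffOp →ₗ[ℂ] ℂ[X] := Finsupp.lapply r

theorem coeff_mono (r s : ℤ) (f : ℂ[X]) : coeff s (mono r f) = if r = s then f else 0 :=
  Finsupp.single_apply

theorem induction {p : DiffOp → Prop} (A : DiffOp) (h0 : p 0)
    (hadd : ∀ A B, p A → p B → p (A + B)) (hmono : ∀ r f, p (mono r f)) : p A :=
  Finsupp.induction_linear A h0 hadd hmono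

/-- The linear map on `𝒟` that is prescribed on the operators `t ^ r f(D)`. -/
def lift {M : Type*} [AddCommGroup M] [Module ℂ M] (φ : ℤ → ℂ[X] →ₗ[ℂ] M) : DiffOp →ₗ[ℂ] M :=
  Finsupp.lsum ℂ φ

theorem lift_mono {M : Type*} [AddCommGroup M] [Module ℂ M] (φ : ℤ → ℂ[X] →ₗ[ℂ] M) (r : ℤ)
    (f : ℂ[X]) : lift φ (mono r f) = φ r f :=
  Finsupp.lsum_single ℂ φ r f

/-- Composition of operators: `t ^ r f(D) ∘ t ^ s g(D) = t ^ (r + s) f(D + s) g(D)`. -/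
def mulLin : DiffOp →ₗ[ℂ] DiffOp →ₗ[ℂ] DiffOp :=
  lift fun r => LinearMap.flip <| lift fun s =>
    LinearMap.mk₂ ℂ (fun g f : ℂ[X] => mono (r + s) (f.comp (X + C (s : ℂ)) * g))
      (fun g g' f => by simp [mul_add]) (fun c g f => by simp)
      (fun g f f' => by simp [add_mul]) (fun c g f => by simp)

instance : Mul DiffOp := ⟨fun A B => mulLin A B⟩

instance : One DiffOp := ⟨mono 0 1⟩

theorem mul_def (A B : DiffOp) : A * B = mulLin A B := rfl

theorem mono_mul_mono (r s : ℤ) (f g : ℂ[X]) :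
    mono r f * mono s g = mono (r + s) (f.comp (X + C (s : ℂ)) * g) := by
  simp [mul_def, mulLin, lift_mono]

theorem one_def : (1 : DiffOp) = mono 0 1 := rfl

instance : Ring DiffOp :=
  { (inferInstance : AddCommGroup DiffOp), (inferInstance : Mul DiffOp),
    (inferInstance : One DiffOp) with
    left_distrib := fun A B C => by simp [mul_def]
    right_distrib := fun A B C => by simp [mul_def]
    zero_mul := fun A => by simp [mul_def]
    mul_zero := fun A => by simp [mul_def]
    mul_assoc := fun A B C => by
      induction A using DiffOp.induction with
      | h0 => simp [mul_def]
      | hadd A A' h h' => simp only [mul_def, map_add, LinearMap.add_apply] at *; rw [h, h']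
      | hmono r f =>
        induction B using DiffOp.induction with
        | h0 => simp [mul_def]
        | hadd A A' h h' => simp only [mul_def, map_add, LinearMap.add_apply] at *; rw [h, h']
        | hmono s g =>
          induction C using DiffOp.induction with
          | h0 => simp [mul_def]
          | hadd A A' h h' => simp only [mul_def, map_add] at *; rw [h, h']
          | hmono u k =>
            simp only [mono_mul_mono, mul_comp, comp_assoc, add_comp, X_comp, C_comp]
            rw [add_assoc, mul_assoc, add_assoc X, ← C_add]
            push_cast
            rw [add_comm (u : ℂ)]
    one_mul := fun A => by
      induction A using DiffOp.induction with
      | h0 => simp [mul_def]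
      | hadd A A' h h' => simp only [mul_def, map_add] at *; rw [h, h']
      | hmono r f => simp [one_def, mono_mul_mono]
    mul_one := fun A => by
      induction A using DiffOp.induction with
      | h0 => simp [mul_def]
      | hadd A A' h h' => simp only [mul_def, map_add, LinearMap.add_apply] at *; rw [h, h']
      | hmono r f => simp [one_def, mono_mul_mono] }

instance : Algebra ℂ DiffOp :=
  Algebra.ofModule (fun c A B => by simp [mul_def]) (fun c A B => by simp [mul_def])

/-- The Lie bracket on `𝒟` is the commutator of operators. -/
instance : LieRing DiffOp := LieRing.ofAssociativeRing

instance : LieAlgebra ℂ DiffOp := LieAlgebra.ofAssociativeAlgebra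

theorem lie_def (A B : DiffOp) : ⁅A, B⁆ = A * B - B * A := rfl

/-- The action on Laurent polynomials: `t ^ r f(D)` sends `t ^ j` to `f(j) t ^ (j + r)`. -/
def toEnd : DiffOp →ₗ[ℂ] Module.End ℂ (LaurentPolynomial ℂ) :=
  lift fun r => LinearMap.mk₂' ℂ ℂ (fun (f : ℂ[X]) (p : LaurentPolynomial ℂ) =>
      (AddMonoidAlgebra.basis ℤ ℂ).constr ℂ
        (fun j : ℤ => f.eval (j : ℂ) • LaurentPolynomial.T (R := ℂ) (j + r)) p)
      (fun f g p => by
        rw [← LinearMap.add_apply, ← map_add]; congr 2; ext1 j; simp [add_smul])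
      (fun c f p => by
        rw [← LinearMap.smul_apply, ← map_smul]; congr 2; ext1 j; simp [mul_smul])
      (fun f p q => by simp) (fun c f p => by simp)

theorem toEnd_mono_T (r j : ℤ) (f : ℂ[X]) :
    toEnd (mono r f) (LaurentPolynomial.T j) = f.eval (j : ℂ) • LaurentPolynomial.T (j + r) := by
  rw [toEnd, lift_mono, LinearMap.mk₂'_apply]
  exact (AddMonoidAlgebra.basis ℤ ℂ).constr_basis ℂ _ j

theorem toEnd_mul (A B : DiffOp) : toEnd (A * B) = toEnd A * toEnd B := by
  induction A using DiffOp.induction with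
  | h0 => simp
  | hadd A A' h h' => simp only [add_mul, map_add, h, h']
  | hmono r f =>
    induction B using DiffOp.induction with
    | h0 => simp
    | hadd A A' h h' => simp only [mul_add, map_add, h, h']
    | hmono s g =>
      refine (AddMonoidAlgebra.basis ℤ ℂ).ext fun j => ?_
      change toEnd _ (LaurentPolynomial.T j) = toEnd _ (toEnd _ (LaurentPolynomial.T j))
      rw [mono_mul_mono, toEnd_mono_T, toEnd_mono_T, map_smul, toEnd_mono_T, smul_smul]
      simp [mul_comm, add_comm, add_left_comm]

theorem coeff_toEnd_T (A : DiffOp) (r j : ℤ) :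
    (toEnd A (LaurentPolynomial.T j)).coeff (j + r) = (coeff r A).eval (j : ℂ) := by
  induction A using DiffOp.induction with
  | h0 => simp
  | hadd A A' h h' => simp only [map_add, LinearMap.add_apply, AddMonoidAlgebra.coeff_add,
      Finsupp.add_apply, h, h', eval_add]
  | hmono s f =>
    rw [toEnd_mono_T, coeff_mono, AddMonoidAlgebra.coeff_smul_apply, LaurentPolynomial.T_apply]
    by_cases h : s = r <;> simp [h]

/-- An element of `𝒟` is determined by the operator on `ℂ[t, t⁻¹]` that it stands for. -/
theorem toEnd_injective : Function.Injective toEnd := by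
  refine (injective_iff_map_eq_zero _).mpr fun A hA => Finsupp.ext fun r => ?_
  refine Polynomial.eq_zero_of_infinite_isRoot (coeff r A) ?_
  refine (Set.infinite_range_of_injective (Int.cast_injective (α := ℂ))).mono ?_
  rintro _ ⟨j, rfl⟩
  have h := coeff_toEnd_T A r j
  rw [hA] at h
  exact h.symm

/-- The derivation `∂_t = t⁻¹ D`. -/
def partialT : DiffOp := mono (-1) X

theorem toEnd_partialT (j : ℤ) : toEnd partialT (LaurentPolynomial.T j) =
    (j : ℂ) • LaurentPolynomial.T (j - 1) := by
  rw [partialT, toEnd_mono_T, eval_X, sub_eq_add_neg]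

/-- The Lie subalgebra `𝒟 ∂_t ^ n` of `𝒟`. -/
def order (n : ℕ) : LieSubalgebra ℂ DiffOp :=
  { LinearMap.range (LinearMap.mulRight ℂ (partialT ^ n)) with
    lie_mem' := by
      rintro _ _ ⟨A, rfl⟩ ⟨B, rfl⟩
      refine ⟨A * partialT ^ n * B - B * partialT ^ n * A, ?_⟩
      simp [lie_def, sub_mul, mul_assoc] }

theorem mem_order (n : ℕ) (A : DiffOp) : A ∈ order n ↔ ∃ B, B * partialT ^ n = A := Iff.rfl

/-! ### The cocycle -/

/-- The sum of `F` over the integers `a ≤ m < b`, counted negatively if `b < a`. -/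
def orientedSum (a b : ℤ) (F : ℤ → ℂ) : ℂ := ∑ m ∈ Finset.Ico a b, F m - ∑ m ∈ Finset.Ico b a, F m

theorem exists_primitive (F : ℤ → ℂ) : ∃ G : ℤ → ℂ, ∀ a b, orientedSum a b F = G b - G a := by
  have step : ∀ a b, a ≤ b → ∑ m ∈ Finset.Ico a (b + 1), F m = ∑ m ∈ Finset.Ico a b, F m + F b := by
    intro a b h
    rw [← Finset.insert_Ico_right_eq_Ico_add_one h, Finset.sum_insert (by simp), add_comm]
  have consec : ∀ a b c, a ≤ b → b ≤ c → ∑ m ∈ Finset.Ico a c, F m =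
      ∑ m ∈ Finset.Ico a b, F m + ∑ m ∈ Finset.Ico b c, F m := by
    intro a b c hab hbc
    rw [← Finset.Ico_union_Ico_eq_Ico hab hbc,
      Finset.sum_union (Finset.Ico_disjoint_Ico_consecutive a b c)]
  refine ⟨fun m => orientedSum 0 m F, fun a b => ?_⟩
  have e : ∀ p q : ℤ, q ≤ p → Finset.Ico p q = ∅ := fun p q h => Finset.Ico_eq_empty (by omega)
  simp only [orientedSum]
  rcases le_total 0 a with h1 | h1 <;> rcases le_total 0 b with h2 | h2 <;>
    rcases le_total a b with h3 | h3
  all_goals simp only [e _ _ h1, e _ _ h2, e _ _ h3, Finset.sum_empty]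
  · rw [consec 0 a b h1 h3]; ring
  · rw [consec 0 b a h2 h3]; ring
  · obtain rfl : a = 0 := by omega
    obtain rfl : b = 0 := by omega
    simp
  · rw [consec b 0 a h2 h1]; ring
  · rw [consec a 0 b h1 h2]; ring
  · obtain rfl : a = 0 := by omega
    obtain rfl : b = 0 := by omega
    simp
  · rw [consec a b 0 h3 h2]; ring
  · rw [consec b a 0 h3 h1]; ring

theorem orientedSum_shift (a b k : ℤ) (F : ℤ → ℂ) :
    orientedSum a b (fun m => F (m + k)) = orientedSum (a + k) (b + k) F := by
  simp only [orientedSum]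
  rw [← Finset.map_add_right_Ico, ← Finset.map_add_right_Ico, Finset.sum_map, Finset.sum_map]
  rfl

theorem orientedSum_add (a b : ℤ) (F G : ℤ → ℂ) :
    orientedSum a b (fun m => F m + G m) = orientedSum a b F + orientedSum a b G := by
  simp only [orientedSum, Finset.sum_add_distrib]; ring

theorem orientedSum_mul (a b : ℤ) (c : ℂ) (F : ℤ → ℂ) :
    orientedSum a b (fun m => c * F m) = c * orientedSum a b F := by
  simp only [orientedSum, ← Finset.mul_sum]; ring

/-- The bilinear form `Ψ` on `𝒟`: one has `Ψ(t ^ r f(D), t ^ s g(D)) = 0` if `r + s ≠ 0`, and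
`Ψ(t ^ r f(D), t ^ (-r) g(D)) = ∑_{-r ≤ m ≤ -1} f(m) g(m + r)` if `r ≥ 0`; the oriented sum extends
this to `r < 0` by skew-symmetry. -/
def psi : DiffOp →ₗ[ℂ] DiffOp →ₗ[ℂ] ℂ :=
  lift fun r => (LinearMap.mk₂ ℂ (fun f g : ℂ[X] =>
      orientedSum (-r) 0 fun m => f.eval (m : ℂ) * g.eval ((m + r : ℤ) : ℂ))
    (fun f f' g => by simp only [eval_add, add_mul, orientedSum_add])
    (fun c f g => by simp only [eval_smul, smul_eq_mul, mul_assoc, orientedSum_mul])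
    (fun f g g' => by simp only [eval_add, mul_add, orientedSum_add])
    (fun c f g => by
      simp only [eval_smul, smul_eq_mul, mul_left_comm, orientedSum_mul])).compl₂ (coeff (-r))

theorem psi_mono (r s : ℤ) (f g : ℂ[X]) : psi (mono r f) (mono s g) =
    if r + s = 0 then orientedSum (-r) 0 fun m => f.eval (m : ℂ) * g.eval ((m + r : ℤ) : ℂ)
    else 0 := by
  rw [psi, lift_mono, LinearMap.compl₂_apply, coeff_mono, LinearMap.mk₂_apply]
  by_cases h : r + s = 0
  · rw [if_pos h, if_pos (by omega)]
  · rw [if_neg h, if_neg (by omega)]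
    simp [orientedSum]

theorem psi_mono_of_nonneg (r : ℤ) (hr : 0 ≤ r) (f g : ℂ[X]) :
    psi (mono r f) (mono (-r) g) =
      ∑ m ∈ Finset.Icc (-r) (-1), f.eval (m : ℂ) * g.eval ((m + r : ℤ) : ℂ) := by
  have h1 : Finset.Ico 0 (-r) = ∅ := Finset.Ico_eq_empty (by omega)
  have h2 : Finset.Ico (-r) 0 = Finset.Icc (-r) (-1) := by ext; simp; omega
  simp [psi_mono, orientedSum, h1, h2]

theorem psi_skew (A B : DiffOp) : psi A B = -psi B A := by
  induction A using DiffOp.induction with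
  | h0 => simp
  | hadd A A' h h' => simp only [map_add, LinearMap.add_apply, h, h', neg_add]
  | hmono r f =>
    induction B using DiffOp.induction with
    | h0 => simp
    | hadd A A' h h' => simp only [map_add, LinearMap.add_apply, h, h', neg_add]
    | hmono s g =>
      rw [psi_mono, psi_mono]
      by_cases h : r + s = 0
      · obtain rfl : s = -r := by omega
        rw [if_pos h, if_pos (by omega)]
        have := orientedSum_shift (-r) 0 r
          fun m => g.eval (m : ℂ) * f.eval ((m + -r : ℤ) : ℂ)
        simp only [add_neg_cancel_right, neg_add_cancel, zero_add] at this
        simp only [neg_neg, orientedSum] at this ⊢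
        rw [neg_sub, ← this]
        simp only [mul_comm]
      · rw [if_neg h, if_neg (by omega), neg_zero]

theorem psi_cyclic (A B E : DiffOp) :
    psi (A * B) E + psi (B * E) A + psi (E * A) B = 0 := by
  induction A using DiffOp.induction with
  | h0 => simp
  | hadd A A' h h' =>
    simp only [map_add, LinearMap.add_apply, add_mul, mul_add]
    linear_combination h + h'
  | hmono r f =>
    induction B using DiffOp.induction with
    | h0 => simp
    | hadd A A' h h' =>
      simp only [map_add, LinearMap.add_apply, add_mul, mul_add]
      linear_combination h + h'
    | hmono s g =>
      induction E using DiffOp.induction with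
      | h0 => simp
      | hadd A A' h h' =>
        simp only [map_add, LinearMap.add_apply, add_mul, mul_add]
        linear_combination h + h'
      | hmono u k =>
        simp only [mono_mul_mono, psi_mono]
        by_cases h : r + s + u = 0
        · obtain rfl : u = -(r + s) := by omega
          rw [if_pos h, if_pos (by omega), if_pos (by omega)]
          obtain ⟨G, hG⟩ := exists_primitive fun m =>
            f.eval ((m + s : ℤ) : ℂ) * g.eval (m : ℂ) * k.eval ((m + (r + s) : ℤ) : ℂ)
          have e1 := hG (-(r + s)) 0
          have e2 := orientedSum_shift (-(s + -(r + s))) 0 (-(r + s)) fun m =>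
            f.eval ((m + s : ℤ) : ℂ) * g.eval (m : ℂ) * k.eval ((m + (r + s) : ℤ) : ℂ)
          have e3 := orientedSum_shift (-(-(r + s) + r)) 0 (-s) fun m =>
            f.eval ((m + s : ℤ) : ℂ) * g.eval (m : ℂ) * k.eval ((m + (r + s) : ℤ) : ℂ)
          rw [hG] at e2 e3
          have : ∀ x y z x' y' z' : ℂ, x = x' → y = y' → z = z' → x' + y' + z' = 0 →
            x + y + z = 0 := by
            rintro _ _ _ _ _ _ rfl rfl rfl h; exact h
          refine this _ _ _ _ _ _ (Eq.trans ?_ e1) (Eq.trans ?_ e2) (Eq.trans ?_ e3) ?_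
          · congr 1; funext m; simp
          · congr 1; funext m; push_cast; simp; ring_nf
          · congr 1; funext m; push_cast; simp; ring_nf
          · ring_nf
        · rw [if_neg h, if_neg (by omega), if_neg (by omega)]; simp

open LieModule.Cohomology in
/-- `Ψ` as a 2-cocycle on `𝒟` with values in the trivial module `ℂ`. -/
def cocycle : twoCocycle ℂ DiffOp (TrivialLieModule ℂ DiffOp ℂ) :=
  ⟨⟨psi.compr₂ (TrivialLieModule.equiv ℂ DiffOp ℂ).symm, by
      intro A
      have h : psi A A = 0 := self_eq_neg.mp (psi_skew A A)
      simp [h]⟩, by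
    rw [mem_twoCocycle_iff_of_trivial]
    intro A B E
    change psi A ⁅B, E⁆ = psi ⁅A, B⁆ E + psi B ⁅A, E⁆
    simp only [lie_def, map_sub, LinearMap.sub_apply]
    have h1 := psi_cyclic A B E
    have h2 := psi_cyclic B A E
    have h3 := psi_skew A (B * E)
    have h4 := psi_skew A (E * B)
    have h5 := psi_skew B (A * E)
    have h6 := psi_skew B (E * A)
    linear_combination h3 - h4 - h5 + h6 - h1 + h2⟩

end DiffOp

/-! ### The Lie algebras `W_{1+∞}` and `W_∞^{(n)}` -/

/-- The central extension `W_{1+∞} = 𝒟 + ℂ C` of `𝒟` given by the cocycle `Ψ`. -/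
abbrev W1 : Type := LieAlgebra.ofTwoCocycle DiffOp.cocycle

namespace W1

/-- The element `A + c C` of `W_{1+∞}`. -/
def mk (A : DiffOp) (c : ℂ) : W1 :=
  LieAlgebra.ofProd DiffOp.cocycle (A, (TrivialLieModule.equiv ℂ DiffOp ℂ).symm c)

/-- The projection `A + c C ↦ A` onto `𝒟`. -/
def op : W1 →ₗ⁅ℂ⁆ DiffOp where
  toFun x := ((LieAlgebra.ofProd DiffOp.cocycle).symm x).1
  map_add' _ _ := rfl
  map_smul' _ _ := rfl
  map_lie' := rfl

/-- The linear form `A + c C ↦ c`. -/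
def central : W1 →ₗ[ℂ] ℂ where
  toFun x := TrivialLieModule.equiv ℂ DiffOp ℂ ((LieAlgebra.ofProd DiffOp.cocycle).symm x).2
  map_add' _ _ := rfl
  map_smul' _ _ := rfl

theorem lie_mk (A B : DiffOp) (a b : ℂ) :
    ⁅mk A a, mk B b⁆ = mk (A * B - B * A) (DiffOp.psi A B) := by
  rw [LieAlgebra.bracket_ofTwoCocycle]
  simp only [mk, Equiv.symm_apply_apply, trivial_lie_zero, add_zero, sub_zero]
  rfl

/-- The principal gradation of `W_{1+∞}`: `t ^ j f(D)` has degree `j` and `C` has degree `0`. -/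
def grading (j : ℤ) : Submodule ℂ W1 :=
  (LinearMap.range (DiffOp.mono j)).comap (op : W1 →ₗ[ℂ] DiffOp) ⊓
    (if j = 0 then ⊤ else LinearMap.ker central)

end W1

/-- The Lie algebra `W_∞^{(n)}`, the central extension of `𝒟 ∂_t ^ n` by `ℂ C` given by the
restriction of `Ψ`, as the subalgebra `𝒟 ∂_t ^ n + ℂ C` of `W_{1+∞}`. -/
def Winf (n : ℕ) : LieSubalgebra ℂ W1 := (DiffOp.order n).comap W1.op

/-- The principal gradation of `W_∞^{(n)}`. -/
def Winf.grading (n : ℕ) (j : ℤ) : Submodule ℂ (Winf n) :=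
  (W1.grading j).comap (Winf n).toSubmodule.subtype

/-! ### Highest weight modules over a graded Lie algebra -/

section HighestWeight

variable {𝔤 : Type*} [LieRing 𝔤] [LieAlgebra ℂ 𝔤] (𝒢 : ℤ → Submodule ℂ 𝔤)

/-- The component of degree `j` of the enveloping algebra `U(𝔤)`: the span of the products
`x₁ ⋯ x_k` of homogeneous elements whose degrees add up to `j`. -/
def envGrading (j : ℤ) : Submodule ℂ (UniversalEnvelopingAlgebra ℂ 𝔤) :=
  Submodule.span ℂ {u | ∃ l : List (ℤ × 𝔤), (∀ p ∈ l, p.2 ∈ 𝒢 p.1) ∧ (l.map Prod.fst).sum = j ∧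
    (l.map fun p => UniversalEnvelopingAlgebra.ι ℂ p.2).prod = u}

/-- The left ideal of `U(𝔤)` generated by the `h - lam(h)`, `h ∈ 𝔤_0`, and by `𝔤_+`. -/
def vermaIdeal (lam : 𝒢 0 →ₗ[ℂ] ℂ) : Submodule (UniversalEnvelopingAlgebra ℂ 𝔤)
    (UniversalEnvelopingAlgebra ℂ 𝔤) :=
  Submodule.span (UniversalEnvelopingAlgebra ℂ 𝔤)
    ({u | ∃ h : 𝒢 0, u = UniversalEnvelopingAlgebra.ι ℂ (h : 𝔤) -
        algebraMap ℂ (UniversalEnvelopingAlgebra ℂ 𝔤) (lam h)} ∪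
      {u | ∃ j > 0, ∃ x ∈ 𝒢 j, u = UniversalEnvelopingAlgebra.ι ℂ x})

/-- The Verma module `M(𝔤, lam) = U(𝔤) ⊗_{U(𝔤_0 + 𝔤_+)} ℂ_lam`, in its standard presentation as
the quotient of `U(𝔤)` by the left ideal which annihilates the highest weight vector. -/
def Verma (lam : 𝒢 0 →ₗ[ℂ] ℂ) : Type _ :=
  UniversalEnvelopingAlgebra ℂ 𝔤 ⧸ vermaIdeal 𝒢 lam

namespace Verma

variable (lam : 𝒢 0 →ₗ[ℂ] ℂ)

instance : AddCommGroup (Verma 𝒢 lam) :=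
  inferInstanceAs (AddCommGroup (UniversalEnvelopingAlgebra ℂ 𝔤 ⧸ vermaIdeal 𝒢 lam))

instance : Module (UniversalEnvelopingAlgebra ℂ 𝔤) (Verma 𝒢 lam) :=
  inferInstanceAs (Module (UniversalEnvelopingAlgebra ℂ 𝔤)
    (UniversalEnvelopingAlgebra ℂ 𝔤 ⧸ vermaIdeal 𝒢 lam))

instance : Module ℂ (Verma 𝒢 lam) :=
  inferInstanceAs (Module ℂ (UniversalEnvelopingAlgebra ℂ 𝔤 ⧸ vermaIdeal 𝒢 lam))

instance : IsScalarTower ℂ (UniversalEnvelopingAlgebra ℂ 𝔤) (Verma 𝒢 lam) :=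
  inferInstanceAs (IsScalarTower ℂ (UniversalEnvelopingAlgebra ℂ 𝔤)
    (UniversalEnvelopingAlgebra ℂ 𝔤 ⧸ vermaIdeal 𝒢 lam))

/-- `𝔤` acts by left multiplication in `U(𝔤)`. -/
instance : LieRingModule 𝔤 (Verma 𝒢 lam) where
  bracket x m := UniversalEnvelopingAlgebra.ι ℂ x • m
  add_lie x y m := by
    rw [map_add, add_smul]
  lie_add x m m' := smul_add _ m m'
  leibniz_lie x y m := by
    change UniversalEnvelopingAlgebra.ι ℂ x • UniversalEnvelopingAlgebra.ι ℂ y • m =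
      UniversalEnvelopingAlgebra.ι ℂ ⁅x, y⁆ • m +
        UniversalEnvelopingAlgebra.ι ℂ y • UniversalEnvelopingAlgebra.ι ℂ x • m
    let _ : LieRing (UniversalEnvelopingAlgebra ℂ 𝔤) := LieRing.ofAssociativeRing
    rw [LieHom.map_lie, LieRing.of_associative_ring_bracket, sub_smul, mul_smul, mul_smul,
      sub_add_cancel]

instance : LieModule ℂ 𝔤 (Verma 𝒢 lam) where
  smul_lie c x m := by
    change UniversalEnvelopingAlgebra.ι ℂ (c • x) • m = c • UniversalEnvelopingAlgebra.ι ℂ x • m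
    rw [map_smul, smul_assoc]
  lie_smul c x m := smul_algebra_smul_comm c (UniversalEnvelopingAlgebra.ι ℂ x) m

/-- The quotient map `U(𝔤) → M(𝔤, lam)`. -/
def proj : UniversalEnvelopingAlgebra ℂ 𝔤 →ₗ[ℂ] Verma 𝒢 lam :=
  (vermaIdeal 𝒢 lam).mkQ.restrictScalars ℂ

/-- The highest weight vector of `M(𝔤, lam)`. -/
def hwVec : Verma 𝒢 lam := proj 𝒢 lam 1

/-- The gradation of `M(𝔤, lam)`. -/
def grading (j : ℤ) : Submodule ℂ (Verma 𝒢 lam) := (envGrading 𝒢 j).map (proj 𝒢 lam)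

/-- A submodule `N` is graded if it is the sum of its homogeneous parts. -/
def IsGraded (N : LieSubmodule ℂ 𝔤 (Verma 𝒢 lam)) : Prop :=
  N.toSubmodule ≤ ⨆ j : ℤ, N.toSubmodule ⊓ grading 𝒢 lam j

/-- The maximal proper graded submodule of `M(𝔤, lam)`: the sum of all proper graded ones. -/
def maxGraded : LieSubmodule ℂ 𝔤 (Verma 𝒢 lam) := sSup {N | IsGraded 𝒢 lam N ∧ N ≠ ⊤}

end Verma

/-- The irreducible highest weight module `L(𝔤, lam)`, the quotient of `M(𝔤, lam)` by its maximal
proper graded submodule. -/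
abbrev Irr (lam : 𝒢 0 →ₗ[ℂ] ℂ) : Type _ := Verma 𝒢 lam ⧸ Verma.maxGraded 𝒢 lam

namespace Irr

variable (lam : 𝒢 0 →ₗ[ℂ] ℂ)

/-- The highest weight vector of `L(𝔤, lam)`. -/
def hwVec : Irr 𝒢 lam := LieSubmodule.Quotient.mk' (Verma.maxGraded 𝒢 lam) (Verma.hwVec 𝒢 lam)

/-- The gradation of `L(𝔤, lam)`. -/
def grading (j : ℤ) : Submodule ℂ (Irr 𝒢 lam) :=
  (Verma.grading 𝒢 lam j).map
    (LieSubmodule.Quotient.mk' (Verma.maxGraded 𝒢 lam) : Verma 𝒢 lam →ₗ[ℂ] Irr 𝒢 lam)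

/-- `L(𝔤, lam)` is quasifinite if all its graded components have finite dimension. -/
def IsQuasifinite : Prop := ∀ j : ℤ, FiniteDimensional ℂ (grading 𝒢 lam j)

end Irr

end HighestWeight

end WInfinity

end

noncomputable section

namespace WInfinity

/-! ### The enveloping algebra and its orbit maps -/

section Enveloping

variable {𝔤 : Type*} [LieRing 𝔤] [LieAlgebra ℂ 𝔤]

local notation "U(" L ")" => UniversalEnvelopingAlgebra ℂ L
open UniversalEnvelopingAlgebra (ι)

/-! Any linear extension `lamt` of `lam` works. Write P = [D]_n, and v for the highest weight vector
of the module under discussion.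

Quasifiniteness of L(lamt). The degree -1 part of L(lam) is finite dimensional, so some t⁻¹ g₀(D)
P(D) with g₀ ≠ 0 kills v (`Winf.exists_killing`), and lam vanishes on its brackets with all t f(D)
P(D). In W_{1+∞} the bracket of t f(D) and t⁻¹ h(D) depends only on f(D - 1) h(D). With b = P(D - 1)
g₀(D) P(D), lamt therefore vanishes on the brackets of all t f(D) with all t⁻¹ b(D) g(D), which
makes the vectors t⁻¹ b(D) g(D) v in L(lamt) singular. They generate a submodule living in negative
degrees, hence zero (`W1.lie_hwVec_of_brackets`). Commutators carry this nonzero killing ideal to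
every negative degree (`W1.exists_killing_ideal`). Its finite codimension there, together with the
bound on the length of words in negative elements, gives quasifiniteness
(`finiteDimensional_words`).

The quotient map. By the universal property M(lam) maps to L(lamt), v going to v, with image the
W_∞^{(n)}-submodule generated by v. The operator D of W_{1+∞} turns degrees into distinct
eigenvalues on the target, so the kernel is graded; it is proper because v ≠ 0. So it lies in the
maximal proper graded submodule, and M(lam) → L(lam) factors through the image.

Both halves need v ≠ 0. Instead of a PBW basis, a representation of W_{1+∞} on U(𝔫), 𝔫 the negative
part, is built with 1 as highest weight vector (`exists_induced`). -/

theorem ι_lie (x y : 𝔤) : ι ℂ ⁅x, y⁆ = ι ℂ x * ι ℂ y - ι ℂ y * ι ℂ x := by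
  let _ : LieRing U(𝔤) := LieRing.ofAssociativeRing
  rw [LieHom.map_lie, LieRing.of_associative_ring_bracket]

/-- `U(𝔤)` is spanned by the words in `𝔤`, in the form of an induction principle. -/
theorem env_induction {p : Submodule ℂ U(𝔤)} (h1 : 1 ∈ p)
    (hι : ∀ (x : 𝔤), ∀ u ∈ p, ι ℂ x * u ∈ p) (u : U(𝔤)) : u ∈ p := by
  -- Stability of `p` under left multiplication by `a`, rather than membership of `a`, is what
  -- passes to products.
  suffices h : ∀ (a : TensorAlgebra ℂ 𝔤), ∀ u ∈ p,
      UniversalEnvelopingAlgebra.mkAlgHom ℂ 𝔤 a * u ∈ p by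
    obtain ⟨a, rfl⟩ : ∃ a, UniversalEnvelopingAlgebra.mkAlgHom ℂ 𝔤 a = u :=
      Quotient.exists_rep u
    simpa using h a 1 h1
  intro a
  induction a using TensorAlgebra.induction with
  | algebraMap r =>
    intro u hu
    rw [AlgHom.commutes, ← Algebra.smul_def]
    exact p.smul_mem r hu
  | ι x => exact fun u hu => hι x u hu
  | mul a b ha hb =>
    intro u hu
    rw [map_mul, mul_assoc]
    exact ha _ (hb _ hu)
  | add a b ha hb =>
    intro u hu
    rw [map_add, add_mul]
    exact p.add_mem (ha _ hu) (hb _ hu)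

variable {V : Type*} [AddCommGroup V] [Module ℂ V] [LieRingModule 𝔤 V] [LieModule ℂ 𝔤 V]

/-- The linear map `U(𝔤) → V`, `u ↦ u v`. -/
def orbit (𝔤 : Type*) [LieRing 𝔤] [LieAlgebra ℂ 𝔤]
    {V : Type*} [AddCommGroup V] [Module ℂ V] [LieRingModule 𝔤 V] [LieModule ℂ 𝔤 V]
    (v : V) : U(𝔤) →ₗ[ℂ] V :=
  (LinearMap.applyₗ v).comp
    (UniversalEnvelopingAlgebra.lift ℂ (LieModule.toEnd ℂ 𝔤 V)).toLinearMap

@[simp] theorem orbit_one (v : V) : orbit 𝔤 v 1 = v := by simp [orbit]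

@[simp] theorem orbit_ι_mul (v : V) (x : 𝔤) (u : U(𝔤)) :
    orbit 𝔤 v (ι ℂ x * u) = ⁅x, orbit 𝔤 v u⁆ := by
  simp only [orbit, LinearMap.comp_apply, AlgHom.toLinearMap_apply, map_mul,
    LinearMap.applyₗ_apply_apply, Module.End.mul_apply, UniversalEnvelopingAlgebra.lift_ι_apply,
    LieModule.toEnd_apply_apply]

theorem orbit_ι (v : V) (x : 𝔤) : orbit 𝔤 v (ι ℂ x) = ⁅x, v⁆ := by
  simpa using orbit_ι_mul v x 1

theorem orbit_mul (v : V) (a u : U(𝔤)) : orbit 𝔤 v (a * u) = orbit 𝔤 (orbit 𝔤 v u) a := by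
  simp [orbit]

theorem map_orbit {V' : Type*} [AddCommGroup V'] [Module ℂ V'] [LieRingModule 𝔤 V']
    [LieModule ℂ 𝔤 V'] (φ : V →ₗ⁅ℂ, 𝔤⁆ V') (v : V) (u : U(𝔤)) :
    φ (orbit 𝔤 v u) = orbit 𝔤 (φ v) u := by
  have := env_induction (p := LinearMap.eqLocus ((φ : V →ₗ[ℂ] V').comp (orbit 𝔤 v))
    (orbit 𝔤 (φ v))) (by simp) (fun x u hu => ?_) u
  · simpa using this
  · simp only [LinearMap.mem_eqLocus, LinearMap.comp_apply, LieModuleHom.coe_toLinearMap,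
      orbit_ι_mul, LieModuleHom.map_lie] at hu ⊢
    rw [hu]

theorem orbit_mem (N : LieSubmodule ℂ 𝔤 V) {v : V} (hv : v ∈ N) (u : U(𝔤)) :
    orbit 𝔤 v u ∈ N := by
  refine env_induction (p := N.toSubmodule.comap (orbit 𝔤 v)) ?_ ?_ u
  · simpa using hv
  · intro x u hu
    simp only [Submodule.mem_comap, orbit_ι_mul] at hu ⊢
    exact N.lie_mem hu

/-! ### Inducing a character of a complementary subalgebra -/

section Induced

attribute [local instance 100] LieRing.ofAssociativeRing

variable (𝔫 : LieSubalgebra ℂ 𝔤)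

/-- The action of `y ∈ 𝔫` on `Hom(𝔤, U(𝔫))`, by `Φ ↦ y ∘ Φ - Φ ∘ ad y`. -/
def homAct (y : 𝔫) : Module.End ℂ (𝔤 →ₗ[ℂ] U(𝔫)) where
  toFun Φ := (LinearMap.mulLeft ℂ (ι ℂ y)).comp Φ - Φ.comp (LieModule.toEnd ℂ 𝔤 𝔤 (y : 𝔤))
  map_add' Φ Ψ := by ext x; simp [mul_add]; abel
  map_smul' c Φ := by ext x; simp [smul_sub]

theorem homAct_apply (y : 𝔫) (Φ : 𝔤 →ₗ[ℂ] U(𝔫)) (x : 𝔤) :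
    homAct 𝔫 y Φ x = ι ℂ y * Φ x - Φ ⁅(y : 𝔤), x⁆ := rfl

/-- The representation of `𝔫` on `Hom(𝔤, U(𝔫))`. -/
def homRep : 𝔫 →ₗ⁅ℂ⁆ Module.End ℂ (𝔤 →ₗ[ℂ] U(𝔫)) where
  toFun := homAct 𝔫
  map_add' y z := by ext Φ x; simp [homAct_apply, add_mul]; abel
  map_smul' c y := by ext Φ x; simp [homAct_apply, smul_sub]
  map_lie' := by
    intro y z
    ext Φ x
    rw [LieRing.of_associative_ring_bracket]
    simp only [homAct_apply, LinearMap.sub_apply, Module.End.mul_apply, LieSubalgebra.coe_bracket,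
      ι_lie, lie_lie, map_sub, sub_mul, mul_sub, mul_assoc]
    abel

variable {𝔫}

/-- The action of `𝔤` on `U(𝔫)` for which `x ∈ 𝔤` sends `1` to `Φ x` and
`x (y u) = y (x u) + [x, y] u` for `y ∈ 𝔫`. -/
def inducedAct (Φ : 𝔤 →ₗ[ℂ] U(𝔫)) : 𝔤 →ₗ[ℂ] Module.End ℂ U(𝔫) :=
  -- The rule for x (y u) is a recursion on words. It is well defined on U(𝔫) because it comes from
  -- a representation of 𝔫: u acts on `Φ` through `homRep`, and the result is evaluated at x.
  LinearMap.flip ((LinearMap.applyₗ Φ).comp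
    (UniversalEnvelopingAlgebra.lift ℂ (homRep 𝔫)).toLinearMap)

theorem inducedAct_one (Φ : 𝔤 →ₗ[ℂ] U(𝔫)) (x : 𝔤) : inducedAct Φ x 1 = Φ x := by
  simp [inducedAct]

theorem inducedAct_ι_mul (Φ : 𝔤 →ₗ[ℂ] U(𝔫)) (x : 𝔤) (y : 𝔫) (u : U(𝔫)) :
    inducedAct Φ x (ι ℂ y * u) = ι ℂ y * inducedAct Φ x u + inducedAct Φ ⁅x, (y : 𝔤)⁆ u := by
  simp only [inducedAct, LinearMap.flip_apply, LinearMap.comp_apply, AlgHom.toLinearMap_apply,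
    map_mul, LinearMap.applyₗ_apply_apply, Module.End.mul_apply,
    UniversalEnvelopingAlgebra.lift_ι_apply]
  change homAct 𝔫 y _ x = _
  rw [homAct_apply, ← lie_skew, map_neg, sub_neg_eq_add, ← neg_neg ⁅x, (y : 𝔤)⁆, lie_skew]

theorem inducedAct_coe {Φ : 𝔤 →ₗ[ℂ] U(𝔫)} (hΦ : ∀ y : 𝔫, Φ y = ι ℂ y) (y : 𝔫) (u : U(𝔫)) :
    inducedAct Φ y u = ι ℂ y * u := by
  revert y
  -- All y are treated at once, since the recursion replaces y by brackets.
  refine env_induction (p := ⨅ y : 𝔫, LinearMap.eqLocus (inducedAct Φ y)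
    (LinearMap.mulLeft ℂ (ι ℂ y))) ?_ ?_ u |> fun h y => by simpa using (Submodule.mem_iInf _).1 h y
  · simp [inducedAct_one, hΦ]
  · intro z u hu
    simp only [Submodule.mem_iInf, LinearMap.mem_eqLocus, LinearMap.mulLeft_apply] at hu ⊢
    intro y
    rw [inducedAct_ι_mul, hu, ← LieSubalgebra.coe_bracket, hu, ι_lie, sub_mul]
    simp only [mul_assoc]
    abel

/-- If `𝔤 = 𝔫 ⊕ 𝔟`, then `U(𝔫)` is a representation of `𝔤` in which `𝔟` acts on `1` by a given
character. The projection to `𝔫` along `𝔟` is `p`, and `χ` is the character. -/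
theorem exists_induced (p : 𝔤 →ₗ[ℂ] 𝔫) (χ : 𝔤 →ₗ[ℂ] ℂ) (hp : ∀ y : 𝔫, p y = y)
    (hχ : ∀ y : 𝔫, χ y = 0) (hpb : ∀ x x', p x = 0 → p x' = 0 → p ⁅x, x'⁆ = 0)
    (hχb : ∀ x x', p x = 0 → p x' = 0 → χ ⁅x, x'⁆ = 0) :
    ∃ ρ : 𝔤 →ₗ⁅ℂ⁆ Module.End ℂ U(𝔫), ∀ x, p x = 0 → ρ x 1 = algebraMap ℂ _ (χ x) := by
  let Φ : 𝔤 →ₗ[ℂ] U(𝔫) := (ι ℂ (L := 𝔫)).toLinearMap.comp p + (Algebra.linearMap ℂ U(𝔫)).comp χ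
  have hΦ : ∀ x, Φ x = ι ℂ (p x) + algebraMap ℂ _ (χ x) := fun x => rfl
  have hΦn : ∀ y : 𝔫, Φ y = ι ℂ y := fun y => by simp [hΦ, hp, hχ]
  -- When one argument lies in 𝔫, the representation property is the recursion itself. On 1,
  -- elements of 𝔟 act by scalars and so commute. These two cases settle everything on 1; Jacobi
  -- then propagates it along words.
  have hn : ∀ (y : 𝔫) (x : 𝔤) (u : U(𝔫)), inducedAct Φ ⁅x, (y : 𝔤)⁆ u =
      inducedAct Φ x (inducedAct Φ y u) - inducedAct Φ y (inducedAct Φ x u) := by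
    intro y x u
    rw [inducedAct_coe hΦn, inducedAct_coe hΦn, inducedAct_ι_mul, add_sub_cancel_left]
  have hb : ∀ x x' : 𝔤, p x = 0 → p x' = 0 → inducedAct Φ ⁅x, x'⁆ 1 =
      inducedAct Φ x (inducedAct Φ x' 1) - inducedAct Φ x' (inducedAct Φ x 1) := by
    intro x x' h h'
    simp only [inducedAct_one, hΦ, h, h', hpb x x' h h', hχb x x' h h', map_zero, zero_add,
      Algebra.algebraMap_eq_smul_one, map_smul, smul_smul]
    rw [mul_comm, sub_self]
  have h1 : ∀ x x' : 𝔤, inducedAct Φ ⁅x, x'⁆ 1 =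
      inducedAct Φ x (inducedAct Φ x' 1) - inducedAct Φ x' (inducedAct Φ x 1) := by
    intro x x'
    obtain ⟨b, hb0, hx⟩ : ∃ b, p b = 0 ∧ x = (p x : 𝔤) + b :=
      ⟨x - p x, by simp [hp], by abel⟩
    obtain ⟨b', hb0', hx'⟩ : ∃ b, p b = 0 ∧ x' = (p x' : 𝔤) + b :=
      ⟨x' - p x', by simp [hp], by abel⟩
    have e1 := hn (p x') x 1
    have e2 := hn (p x) b' 1
    have e3 := hb b b' hb0 hb0'
    generalize p x = y at *
    generalize p x' = y' at *
    subst hx hx'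
    rw [← lie_skew, map_neg, LinearMap.neg_apply, neg_eq_iff_eq_neg] at e2
    simp only [lie_add, add_lie, map_add, LinearMap.add_apply] at e1 e2 e3 ⊢
    rw [e1, e2, e3]
    abel
  have key : ∀ (u : U(𝔫)) (x x' : 𝔤), inducedAct Φ ⁅x, x'⁆ u =
      inducedAct Φ x (inducedAct Φ x' u) - inducedAct Φ x' (inducedAct Φ x u) := by
    intro u
    refine env_induction (p := ⨅ x : 𝔤, ⨅ x' : 𝔤, LinearMap.eqLocus (inducedAct Φ ⁅x, x'⁆)
      (inducedAct Φ x * inducedAct Φ x' - inducedAct Φ x' * inducedAct Φ x)) ?_ ?_ u |>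
      fun h x x' => by simpa using (Submodule.mem_iInf _).1 ((Submodule.mem_iInf _).1 h x) x'
    · simpa using h1
    · intro y u hu
      simp only [Submodule.mem_iInf, LinearMap.mem_eqLocus, LinearMap.sub_apply,
        Module.End.mul_apply] at hu ⊢
      intro x x'
      have e : ⁅⁅x, x'⁆, (y : 𝔤)⁆ = ⁅x, ⁅x', (y : 𝔤)⁆⁆ - ⁅x', ⁅x, (y : 𝔤)⁆⁆ := lie_lie _ _ _
      rw [inducedAct_ι_mul, e, map_sub, LinearMap.sub_apply]
      simp only [inducedAct_ι_mul, map_add, hu, mul_sub]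
      abel
  refine ⟨{ inducedAct Φ with map_lie' := fun {x x'} => ?_ }, fun x hx => ?_⟩
  · ext u
    exact key u x x'
  · change inducedAct Φ x 1 = _
    rw [inducedAct_one, hΦ, hx, map_zero, zero_add]

/-- The one-dimensional trivial representation sends 1 to the identity. -/
theorem env_one_ne_zero (L : Type*) [LieRing L] [LieAlgebra ℂ L] : (1 : U(L)) ≠ 0 := by
  intro h
  have := congrArg (UniversalEnvelopingAlgebra.lift ℂ (0 : L →ₗ⁅ℂ⁆ Module.End ℂ ℂ)) h
  simp at this

end Induced

end Enveloping

/-! ### Highest weight modules over a graded Lie algebra -/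

section Graded

variable {𝔤 : Type*} [LieRing 𝔤] [LieAlgebra ℂ 𝔤]

open UniversalEnvelopingAlgebra (ι)

/-- The subspaces `𝒢 j` span `𝔤` and are compatible with the bracket. -/
structure IsLieGrading (𝒢 : ℤ → Submodule ℂ 𝔤) : Prop where
  lie_mem : ∀ {i j : ℤ} {x y : 𝔤}, x ∈ 𝒢 i → y ∈ 𝒢 j → ⁅x, y⁆ ∈ 𝒢 (i + j)
  iSup_eq_top : ⨆ j, 𝒢 j = ⊤

/-! ### Words in elements of negative degree -/

section Words

variable {V : Type*} [AddCommGroup V] [Module ℂ V] [LieRingModule 𝔤 V] [LieModule ℂ 𝔤 V]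

/-- The action of `𝔤` on `V` as a bilinear map. -/
def act (𝔤 V : Type*) [LieRing 𝔤] [LieAlgebra ℂ 𝔤] [AddCommGroup V] [Module ℂ V]
    [LieRingModule 𝔤 V] [LieModule ℂ 𝔤 V] : 𝔤 →ₗ[ℂ] V →ₗ[ℂ] V :=
  (LieModule.toEnd ℂ 𝔤 V : 𝔤 →ₗ[ℂ] Module.End ℂ V)

variable (𝒢 : ℤ → Submodule ℂ 𝔤)

/-- The span of the `x₁ ⋯ x_k s` with `k ≤ r`, `s ∈ S` and `x_i` homogeneous of negative degree,
where the degrees add up to `j`. -/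
def words (S : Submodule ℂ V) : ℕ → ℤ → Submodule ℂ V
  | 0, j => if j = 0 then S else ⊥
  | r + 1, j => words S r j ⊔ ⨆ i : ℤ, ⨆ _ : i < 0,
      Submodule.map₂ (act 𝔤 V) (𝒢 i) (words S r (j - i))

variable {𝒢} {S : Submodule ℂ V}

theorem words_le_succ (r : ℕ) (j : ℤ) : words 𝒢 S r j ≤ words 𝒢 S (r + 1) j := le_sup_left

theorem lie_mem_words {r : ℕ} {i j : ℤ} (hi : i < 0) {x : 𝔤} (hx : x ∈ 𝒢 i) {w : V}
    (hw : w ∈ words 𝒢 S r j) : ⁅x, w⁆ ∈ words 𝒢 S (r + 1) (i + j) := by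
  refine Submodule.mem_sup_right (Submodule.mem_iSup_of_mem i (Submodule.mem_iSup_of_mem hi ?_))
  refine Submodule.apply_mem_map₂ (act 𝔤 V) hx ?_
  rwa [add_sub_cancel_left]

theorem words_succ_le {r : ℕ} {j : ℤ} {N : Submodule ℂ V} (h : words 𝒢 S r j ≤ N)
    (h' : ∀ i k : ℤ, i < 0 → i + k = j → ∀ y ∈ 𝒢 i, ∀ w ∈ words 𝒢 S r k, ⁅y, w⁆ ∈ N) :
    words 𝒢 S (r + 1) j ≤ N := by
  refine sup_le h (iSup₂_le fun i hi => Submodule.map₂_le.2 fun y hy w hw => ?_)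
  exact h' i (j - i) hi (by ring) y hy w hw

theorem words_eq_bot (r : ℕ) {j : ℤ} (hj : 0 < j) : words 𝒢 S r j = ⊥ := by
  induction r generalizing j with
  | zero => rw [words, if_neg (by omega)]
  | succ r ih =>
    refine le_bot_iff.1 (words_succ_le (ih hj).le fun i k hi hk y _ w hw => ?_)
    rw [ih (by omega), Submodule.mem_bot] at hw
    simp [hw]

theorem words_zero_le (r : ℕ) : words 𝒢 S r 0 ≤ S := by
  induction r with
  | zero => simp [words]
  | succ r ih =>
    refine words_succ_le ih fun i k hi hk y _ w hw => ?_
    rw [words_eq_bot r (by omega), Submodule.mem_bot] at hw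
    simp [hw]

/-- Each letter has degree at most -1, so a word of degree j has at most -j letters. -/
theorem words_stable (r : ℕ) {j : ℤ} (hj : -j ≤ r) : words 𝒢 S (r + 1) j ≤ words 𝒢 S r j := by
  induction r generalizing j with
  | zero =>
    refine words_succ_le le_rfl fun i k hi hk y _ w hw => ?_
    push_cast at hj
    rw [words_eq_bot 0 (by omega), Submodule.mem_bot] at hw
    simp [hw]
  | succ r ih =>
    refine words_succ_le le_rfl fun i k hi hk y hy w hw => ?_
    push_cast at hj
    subst hk
    exact lie_mem_words hi hy (ih (by omega) hw)

theorem words_le_words_natAbs (r : ℕ) (j : ℤ) : words 𝒢 S r j ≤ words 𝒢 S j.natAbs j := by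
  rcases le_total r j.natAbs with h | h
  · exact monotone_nat_of_le_succ (f := fun r => words 𝒢 S r j) (fun r => words_le_succ r j) h
  · induction r, h using Nat.le_induction with
    | base => exact le_rfl
    | succ r hr ih => exact (words_stable r (by omega)).trans ih

/-- Straightening: if `S` is stable under `𝔤_0` and killed by `𝔤_+`, words in letters of arbitrary
degree reduce to words in letters of negative degree. -/
theorem lie_mem_words_of_singular (h𝒢 : IsLieGrading 𝒢)
    (h0 : ∀ x ∈ 𝒢 0, ∀ s ∈ S, ⁅x, s⁆ ∈ S) (hpos : ∀ i > 0, ∀ x ∈ 𝒢 i, ∀ s ∈ S, ⁅x, s⁆ = 0)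
    (r : ℕ) {i j : ℤ} {x : 𝔤} (hx : x ∈ 𝒢 i) {w : V} (hw : w ∈ words 𝒢 S r j) :
    ⁅x, w⁆ ∈ words 𝒢 S (r + 1) (i + j) := by
  rcases lt_or_ge i 0 with hi | hi
  · exact lie_mem_words hi hx hw
  induction r generalizing i j x w with
  | zero =>
    by_cases hj : j = 0
    · subst hj
      simp only [words, if_true] at hw
      rcases hi.lt_or_eq with h | h
      · rw [hpos i h x hx w hw]; exact Submodule.zero_mem _
      · subst h
        refine words_le_succ 0 _ ?_
        simpa [words] using h0 x hx w hw
    · simp only [words, if_neg hj, Submodule.mem_bot] at hw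
      simp [hw]
  | succ r ih =>
    have h : words 𝒢 S (r + 1) j ≤ (words 𝒢 S (r + 1 + 1) (i + j)).comap (act 𝔤 V x) := by
      refine words_succ_le (fun w hw => words_le_succ _ _ (ih hx hw hi)) ?_
      -- Move x past the first letter y. The bracket [x, y] is again a letter if its degree is
      -- negative; otherwise it acts on the shorter word w', as x does, and induction applies.
      intro k l hk hkl y hy w' hw'
      subst hkl
      change ⁅x, ⁅y, w'⁆⁆ ∈ words 𝒢 S (r + 1 + 1) (i + (k + l))
      rw [leibniz_lie]
      refine Submodule.add_mem _ ?_ ?_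
      · refine words_le_succ _ _ ?_
        rw [← add_assoc]
        rcases lt_or_ge (i + k) 0 with h | h
        · exact lie_mem_words h (h𝒢.lie_mem hx hy) hw'
        · exact ih (h𝒢.lie_mem hx hy) hw' h
      · rw [add_left_comm]
        exact lie_mem_words hk hy (ih hx hw' hi)
    exact h hw

theorem IsLieGrading.lie_mem_of_homogeneous (h𝒢 : IsLieGrading 𝒢) {N : Submodule ℂ V} {w : V}
    (h : ∀ i, ∀ x ∈ 𝒢 i, ⁅x, w⁆ ∈ N) (x : 𝔤) : ⁅x, w⁆ ∈ N := by
  have : (⊤ : Submodule ℂ 𝔤) ≤ N.comap ((act 𝔤 V).flip w) := by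
    rw [← h𝒢.iSup_eq_top]
    exact iSup_le fun i x hx => h i x hx
  exact this (Submodule.mem_top (x := x))

theorem IsLieGrading.lie_mem_of_eq (h𝒢 : IsLieGrading 𝒢) {i j k : ℤ} (h : i + j = k) {x y : 𝔤}
    (hx : x ∈ 𝒢 i) (hy : y ∈ 𝒢 j) : ⁅x, y⁆ ∈ 𝒢 k :=
  h ▸ h𝒢.lie_mem hx hy

/-- The `𝔤`-submodule generated by a subspace that is stable under `𝔤_0` and killed by `𝔤_+`. -/
def wordsSubmodule (h𝒢 : IsLieGrading 𝒢) (h0 : ∀ x ∈ 𝒢 0, ∀ s ∈ S, ⁅x, s⁆ ∈ S)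
    (hpos : ∀ i > 0, ∀ x ∈ 𝒢 i, ∀ s ∈ S, ⁅x, s⁆ = 0) : LieSubmodule ℂ 𝔤 V :=
  { (⨆ r, ⨆ j, words 𝒢 S r j : Submodule ℂ V) with
    lie_mem := by
      intro x m hm
      have h : (⨆ r, ⨆ j, words 𝒢 S r j) ≤
          (⨆ r, ⨆ j, words 𝒢 S r j : Submodule ℂ V).comap (act 𝔤 V x) := by
        refine iSup₂_le fun r j w hw => ?_
        change ⁅x, w⁆ ∈ (⨆ r, ⨆ j, words 𝒢 S r j : Submodule ℂ V)
        refine h𝒢.lie_mem_of_homogeneous (fun i x hx => ?_) x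
        exact Submodule.mem_iSup_of_mem _ (Submodule.mem_iSup_of_mem _
          (lie_mem_words_of_singular h𝒢 h0 hpos r hx hw))
      exact h hm }

theorem le_wordsSubmodule (h𝒢 : IsLieGrading 𝒢) (h0 : ∀ x ∈ 𝒢 0, ∀ s ∈ S, ⁅x, s⁆ ∈ S)
    (hpos : ∀ i > 0, ∀ x ∈ 𝒢 i, ∀ s ∈ S, ⁅x, s⁆ = 0) :
    S ≤ (wordsSubmodule h𝒢 h0 hpos).toSubmodule :=
  le_iSup_of_le 0 (le_iSup_of_le 0 (by simp [words]))

/-- Elements of negative degree that kill `S` do not lengthen words. -/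
theorem lie_mem_words_of_kills (h𝒢 : IsLieGrading 𝒢) (r : ℕ) {i j : ℤ} (hi : i < 0) {x : 𝔤}
    (hx : x ∈ 𝒢 i) (hxS : ∀ s ∈ S, ⁅x, s⁆ = 0) {w : V} (hw : w ∈ words 𝒢 S r j) :
    ⁅x, w⁆ ∈ words 𝒢 S r (i + j) := by
  induction r generalizing j w with
  | zero =>
    by_cases hj : j = 0
    · subst hj
      simp only [words, if_true] at hw
      rw [hxS w hw]; exact Submodule.zero_mem _
    · simp only [words, if_neg hj, Submodule.mem_bot] at hw
      simp [hw]
  | succ r ih =>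
    have h : words 𝒢 S (r + 1) j ≤ (words 𝒢 S (r + 1) (i + j)).comap (act 𝔤 V x) := by
      refine words_succ_le (fun w hw => words_le_succ _ _ (ih hw)) ?_
      intro k l hk hkl y hy w' hw'
      subst hkl
      change ⁅x, ⁅y, w'⁆⁆ ∈ words 𝒢 S (r + 1) (i + (k + l))
      rw [leibniz_lie]
      refine Submodule.add_mem _ ?_ ?_
      · rw [← add_assoc]
        exact lie_mem_words (by omega) (h𝒢.lie_mem hx hy) hw'
      · rw [add_left_comm]
        exact lie_mem_words hk hy (ih hw')
    exact h hw

/-- If each `𝔤_i`, `i < 0`, has a subspace of finite codimension that kills the finite dimensional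
space `S`, then each space of words is finite dimensional. -/
theorem finiteDimensional_words (h𝒢 : IsLieGrading 𝒢) [FiniteDimensional ℂ S]
    (T : ℤ → Submodule ℂ 𝔤) [∀ i, FiniteDimensional ℂ (T i)]
    (hT : ∀ i < 0, ∀ x ∈ 𝒢 i, ∃ t ∈ T i, x - t ∈ 𝒢 i ∧ ∀ s ∈ S, ⁅x - t, s⁆ = 0) (r : ℕ) (j : ℤ) :
    FiniteDimensional ℂ (words 𝒢 S r j) := by
  induction r generalizing j with
  | zero =>
    by_cases hj : j = 0
    · rw [words, if_pos hj]; infer_instance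
    · rw [words, if_neg hj]; infer_instance
  | succ r ih =>
    -- Split a letter y as (y - t) + t. The first part kills `S` and does not lengthen the word; the
    -- second ranges over a finite dimensional space. Only degrees i ≥ j matter, because the rest of
    -- the word has degree j - i ≤ 0.
    have hle : words 𝒢 S (r + 1) j ≤ words 𝒢 S r j ⊔ ⨆ i : Set.Ico j 0,
        Submodule.map₂ (act 𝔤 V) (T i) (words 𝒢 S r (j - i)) := by
      refine words_succ_le le_sup_left fun i k hi hk y hy w hw => ?_
      subst hk
      rcases lt_or_ge 0 k with h | h
      · rw [words_eq_bot r h, Submodule.mem_bot] at hw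
        simp [hw]
      obtain ⟨t, ht, htx, hts⟩ := hT i hi y hy
      have : ⁅y, w⁆ = ⁅y - t, w⁆ + ⁅t, w⁆ := by simp
      rw [this]
      refine Submodule.add_mem_sup (lie_mem_words_of_kills h𝒢 r hi htx hts hw) ?_
      refine Submodule.mem_iSup_of_mem (⟨i, by omega, hi⟩ : Set.Ico (i + k) 0) ?_
      refine Submodule.apply_mem_map₂ (act 𝔤 V) ht ?_
      rwa [add_sub_cancel_left]
    have : ∀ i : Set.Ico j 0, FiniteDimensional ℂ
        (Submodule.map₂ (act 𝔤 V) (T i) (words 𝒢 S r (j - i))) := fun i => by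
      have h1 := Module.Finite.iff_fg.1 (inferInstance : FiniteDimensional ℂ (T i))
      have h2 := Module.Finite.iff_fg.1 (ih (j - i))
      exact Module.Finite.iff_fg.2 (h1.map₂ (act 𝔤 V) h2)
    exact Submodule.finiteDimensional_of_le hle

end Words

/-! ### Verma modules and their irreducible quotients -/

section Verma

variable {𝒢 : ℤ → Submodule ℂ 𝔤} {lam : 𝒢 0 →ₗ[ℂ] ℂ}
variable {V : Type*} [AddCommGroup V] [Module ℂ V] [LieRingModule 𝔤 V] [LieModule ℂ 𝔤 V]

/-- The vector `v` has weight `lam` and is killed by the elements of positive degree. -/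
structure IsHighestWeight (𝒢 : ℤ → Submodule ℂ 𝔤) (lam : 𝒢 0 →ₗ[ℂ] ℂ) (v : V) : Prop where
  weight : ∀ h : 𝒢 0, ⁅(h : 𝔤), v⁆ = lam h • v
  pos : ∀ i > 0, ∀ x ∈ 𝒢 i, ⁅x, v⁆ = 0

theorem Verma.lie_proj (x : 𝔤) (u : UniversalEnvelopingAlgebra ℂ 𝔤) :
    ⁅x, Verma.proj 𝒢 lam u⁆ = Verma.proj 𝒢 lam (ι ℂ x * u) := rfl

theorem Verma.proj_surjective : Function.Surjective (Verma.proj 𝒢 lam) :=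
  Submodule.mkQ_surjective (vermaIdeal 𝒢 lam)

theorem Verma.proj_eq_zero {u : UniversalEnvelopingAlgebra ℂ 𝔤} :
    Verma.proj 𝒢 lam u = 0 ↔ u ∈ vermaIdeal 𝒢 lam :=
  Submodule.Quotient.mk_eq_zero (vermaIdeal 𝒢 lam)

theorem Verma.isHighestWeight : IsHighestWeight 𝒢 lam (Verma.hwVec 𝒢 lam) where
  weight h := by
    rw [Verma.hwVec, Verma.lie_proj, ← map_smul, ← sub_eq_zero, ← map_sub, Verma.proj_eq_zero,
      mul_one, ← Algebra.algebraMap_eq_smul_one]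
    exact Submodule.subset_span (Or.inl ⟨h, rfl⟩)
  pos i hi x hx := by
    rw [Verma.hwVec, Verma.lie_proj, Verma.proj_eq_zero, mul_one]
    exact Submodule.subset_span (Or.inr ⟨i, hi, x, hx, rfl⟩)

omit [LieModule ℂ 𝔤 V] in
theorem IsHighestWeight.map {v : V} (hv : IsHighestWeight 𝒢 lam v)
    {V' : Type*} [AddCommGroup V'] [Module ℂ V'] [LieRingModule 𝔤 V'] [LieModule ℂ 𝔤 V']
    (φ : V →ₗ⁅ℂ, 𝔤⁆ V') : IsHighestWeight 𝒢 lam (φ v) where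
  weight h := by rw [← LieModuleHom.map_lie, hv.weight, map_smul]
  pos i hi x hx := by rw [← LieModuleHom.map_lie, hv.pos i hi x hx, map_zero]

theorem Irr.isHighestWeight : IsHighestWeight 𝒢 lam (Irr.hwVec 𝒢 lam) :=
  Verma.isHighestWeight.map _

theorem Verma.proj_eq_orbit (u : UniversalEnvelopingAlgebra ℂ 𝔤) :
    Verma.proj 𝒢 lam u = orbit 𝔤 (Verma.hwVec 𝒢 lam) u := by
  refine env_induction (p := LinearMap.eqLocus (Verma.proj 𝒢 lam)
    (orbit 𝔤 (Verma.hwVec 𝒢 lam))) ?_ (fun x u hu => ?_) u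
  · simp [Verma.hwVec]
  · rw [LinearMap.mem_eqLocus] at hu ⊢
    rw [orbit_ι_mul, ← hu, Verma.lie_proj]

/-- The universal property of the Verma module. -/
theorem IsHighestWeight.exists_hom {v : V} (hv : IsHighestWeight 𝒢 lam v) :
    ∃ φ : Verma 𝒢 lam →ₗ⁅ℂ, 𝔤⁆ V, φ (Verma.hwVec 𝒢 lam) = v := by
  have key : ∀ u, Verma.proj 𝒢 lam u = 0 → orbit 𝔤 v u = 0 := by
    intro u hu
    rw [Verma.proj_eq_zero] at hu
    induction hu using Submodule.span_induction with
    | mem u hu =>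
      rcases hu with ⟨h, rfl⟩ | ⟨i, hi, x, hx, rfl⟩
      · rw [map_sub, orbit_ι, hv.weight, Algebra.algebraMap_eq_smul_one, map_smul, orbit_one,
          sub_self]
      · rw [orbit_ι, hv.pos i hi x hx]
    | zero => simp
    | add a b _ _ ha hb => rw [map_add, ha, hb, add_zero]
    | smul a u _ hu => rw [smul_eq_mul, orbit_mul, hu]; simp [orbit]
  let g : Verma 𝒢 lam →ₗ[ℂ] V :=
    (LinearMap.ker (Verma.proj 𝒢 lam)).liftQ (orbit 𝔤 v) (fun u hu => key u hu) ∘ₗ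
      (LinearMap.quotKerEquivOfSurjective _ Verma.proj_surjective).symm.toLinearMap
  have hg : ∀ u, g (Verma.proj 𝒢 lam u) = orbit 𝔤 v u := by
    intro u
    have : (LinearMap.quotKerEquivOfSurjective _ Verma.proj_surjective).symm
        (Verma.proj 𝒢 lam u) = Submodule.Quotient.mk u := by
      rw [LinearEquiv.symm_apply_eq]; rfl
    simp only [g, LinearMap.comp_apply, LinearEquiv.coe_coe, this]
    exact Submodule.liftQ_apply _ _ _
  refine ⟨{ g with map_lie' := fun {x m} => ?_ }, ?_⟩
  · obtain ⟨u, rfl⟩ := Verma.proj_surjective m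
    change g ⁅x, _⁆ = ⁅x, g _⁆
    rw [Verma.lie_proj, hg, hg, orbit_ι_mul]
  · change g (Verma.proj 𝒢 lam 1) = v
    rw [hg, orbit_one]

theorem IsHighestWeight.mem_span {v : V} (hv : IsHighestWeight 𝒢 lam v) :
    ∀ x ∈ 𝒢 0, ∀ s ∈ Submodule.span ℂ {v}, ⁅x, s⁆ ∈ Submodule.span ℂ {v} := by
  intro x hx s hs
  obtain ⟨c, rfl⟩ := Submodule.mem_span_singleton.1 hs
  rw [lie_smul, hv.weight ⟨x, hx⟩]
  exact Submodule.smul_mem _ _ (Submodule.smul_mem _ _ (Submodule.mem_span_singleton_self v))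

theorem IsHighestWeight.pos_span {v : V} (hv : IsHighestWeight 𝒢 lam v) :
    ∀ i > 0, ∀ x ∈ 𝒢 i, ∀ s ∈ Submodule.span ℂ {v}, ⁅x, s⁆ = 0 := by
  intro i hi x hx s hs
  obtain ⟨c, rfl⟩ := Submodule.mem_span_singleton.1 hs
  rw [lie_smul, hv.pos i hi x hx, smul_zero]

/-- Straightening, with a length bound that depends on j alone; this uniformity yields finite
dimensional components. -/
theorem IsHighestWeight.orbit_mem_words (h𝒢 : IsLieGrading 𝒢) {v : V}
    (hv : IsHighestWeight 𝒢 lam v) {j : ℤ} {u : UniversalEnvelopingAlgebra ℂ 𝔤}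
    (hu : u ∈ envGrading 𝒢 j) : orbit 𝔤 v u ∈ words 𝒢 (Submodule.span ℂ {v}) j.natAbs j := by
  suffices h : envGrading 𝒢 j ≤
      (words 𝒢 (Submodule.span ℂ {v}) j.natAbs j).comap (orbit 𝔤 v) from h hu
  clear hu
  refine Submodule.span_le.2 ?_
  rintro _ ⟨l, hl, rfl, rfl⟩
  refine words_le_words_natAbs l.length _ ?_
  induction l with
  | nil => simp [words]
  | cons p l ih =>
    simp only [List.map_cons, List.prod_cons, List.sum_cons, List.length_cons, orbit_ι_mul]
    exact lie_mem_words_of_singular h𝒢 hv.mem_span hv.pos_span _ (hl p (by simp))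
      (ih fun q hq => hl q (by simp [hq]))

theorem ι_mul_mem_envGrading {i j : ℤ} {x : 𝔤} (hx : x ∈ 𝒢 i)
    {u : UniversalEnvelopingAlgebra ℂ 𝔤} (hu : u ∈ envGrading 𝒢 j) :
    ι ℂ x * u ∈ envGrading 𝒢 (i + j) := by
  suffices h : envGrading 𝒢 j ≤ (envGrading 𝒢 (i + j)).comap (LinearMap.mulLeft ℂ (ι ℂ x)) from h hu
  refine Submodule.span_le.2 ?_
  rintro _ ⟨l, hl, rfl, rfl⟩
  refine Submodule.subset_span ⟨(i, x) :: l, ?_, by simp, by simp⟩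
  rintro p hp
  rcases List.mem_cons.1 hp with rfl | hp
  · exact hx
  · exact hl p hp

theorem one_mem_envGrading : (1 : UniversalEnvelopingAlgebra ℂ 𝔤) ∈ envGrading 𝒢 0 :=
  Submodule.subset_span ⟨[], by simp, by simp, by simp⟩

theorem IsLieGrading.iSup_envGrading (h𝒢 : IsLieGrading 𝒢) : ⨆ j, envGrading 𝒢 j = ⊤ := by
  refine Submodule.eq_top_iff'.2 (env_induction (Submodule.mem_iSup_of_mem 0 one_mem_envGrading) ?_)
  intro x u hu
  let _ : LieRing (UniversalEnvelopingAlgebra ℂ 𝔤) := LieRing.ofAssociativeRing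
  have : (⊤ : Submodule ℂ 𝔤) ≤ (⨆ j, envGrading 𝒢 j).comap
      ((LinearMap.mulRight ℂ u).comp (ι ℂ (L := 𝔤)).toLinearMap) := by
    rw [← h𝒢.iSup_eq_top]
    refine iSup_le fun i y hy => ?_
    suffices h : (⨆ j, envGrading 𝒢 j) ≤
      (⨆ j, envGrading 𝒢 j).comap (LinearMap.mulLeft ℂ (ι ℂ y)) from h hu
    exact iSup_le fun j w hw => Submodule.mem_iSup_of_mem _ (ι_mul_mem_envGrading hy hw)
  exact this (Submodule.mem_top (x := x))

theorem IsLieGrading.iSup_grading (h𝒢 : IsLieGrading 𝒢) : ⨆ j, Verma.grading 𝒢 lam j = ⊤ := by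
  simp only [Verma.grading]
  rw [← Submodule.map_iSup, h𝒢.iSup_envGrading, Submodule.map_top, LinearMap.range_eq_top]
  exact Verma.proj_surjective

theorem Verma.lie_mem_grading {i j : ℤ} {x : 𝔤} (hx : x ∈ 𝒢 i) {m : Verma 𝒢 lam}
    (hm : m ∈ Verma.grading 𝒢 lam j) : ⁅x, m⁆ ∈ Verma.grading 𝒢 lam (i + j) := by
  obtain ⟨u, hu, rfl⟩ := hm
  exact ⟨_, ι_mul_mem_envGrading hx hu, rfl⟩

theorem Verma.hwVec_mem_grading : Verma.hwVec 𝒢 lam ∈ Verma.grading 𝒢 lam 0 :=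
  ⟨1, one_mem_envGrading, rfl⟩

/-- A word of degree zero in negative letters is empty. -/
theorem Verma.grading_zero_le (h𝒢 : IsLieGrading 𝒢) :
    Verma.grading 𝒢 lam 0 ≤ Submodule.span ℂ {Verma.hwVec 𝒢 lam} := by
  rintro _ ⟨u, hu, rfl⟩
  rw [Verma.proj_eq_orbit]
  exact words_zero_le _ (Verma.isHighestWeight.orbit_mem_words h𝒢 hu)

theorem Verma.eq_top_of_hwVec_mem {N : LieSubmodule ℂ 𝔤 (Verma 𝒢 lam)}
    (h : Verma.hwVec 𝒢 lam ∈ N) : N = ⊤ := by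
  refine eq_top_iff.2 fun m _ => ?_
  obtain ⟨u, rfl⟩ := Verma.proj_surjective m
  rw [Verma.proj_eq_orbit]
  exact orbit_mem N h u

/-- The degree zero part of a proper graded submodule vanishes: it lies in the line of a generator
of the whole module. Directness of the gradation is not used; eigenspaces supply the independence
later. -/
theorem Verma.maxGraded_le (h𝒢 : IsLieGrading 𝒢) :
    (Verma.maxGraded 𝒢 lam).toSubmodule ≤ ⨆ j : ℤ, ⨆ _ : j ≠ 0, Verma.grading 𝒢 lam j := by
  rw [Verma.maxGraded, LieSubmodule.sSup_toSubmodule]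
  refine sSup_le ?_
  rintro _ ⟨N, ⟨hN, hN'⟩, rfl⟩
  refine hN.trans (iSup_le fun j => ?_)
  by_cases hj : j = 0
  · subst hj
    rintro m ⟨hm, hm0⟩
    obtain ⟨c, rfl⟩ := Submodule.mem_span_singleton.1 (Verma.grading_zero_le h𝒢 hm0)
    rcases eq_or_ne c 0 with rfl | hc
    · simp
    · refine absurd (Verma.eq_top_of_hwVec_mem ?_) hN'
      simpa [smul_smul, inv_mul_cancel₀ hc] using N.smul_mem c⁻¹ hm
  · exact inf_le_right.trans (le_iSup₂_of_le j hj le_rfl)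

/-- A criterion for `L(lam) ≠ 0`: some linear map turns the grading into eigenspaces and does
not kill the highest weight vector. -/
theorem Irr.hwVec_ne_zero (h𝒢 : IsLieGrading 𝒢) {E : Type*} [AddCommGroup E] [Module ℂ E]
    (φ : Verma 𝒢 lam →ₗ[ℂ] E) (d : Module.End ℂ E) (μ : ℂ)
    (hφ : ∀ j, ∀ m ∈ Verma.grading 𝒢 lam j, φ m ∈ d.eigenspace (μ + j))
    (hv : φ (Verma.hwVec 𝒢 lam) ≠ 0) : Irr.hwVec 𝒢 lam ≠ 0 := by
  intro h
  have hmem : Verma.hwVec 𝒢 lam ∈ Verma.maxGraded 𝒢 lam := (LieSubmodule.Quotient.mk_eq_zero _).1 h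
  have h1 : φ (Verma.hwVec 𝒢 lam) ∈ ⨆ c : ℂ, ⨆ _ : c ≠ μ, d.eigenspace c := by
    suffices h : (⨆ j : ℤ, ⨆ _ : j ≠ 0, Verma.grading 𝒢 lam j) ≤
      (⨆ c : ℂ, ⨆ _ : c ≠ μ, d.eigenspace c).comap φ from h (Verma.maxGraded_le h𝒢 hmem)
    refine iSup₂_le fun j hj m hm => ?_
    exact Submodule.mem_iSup_of_mem (μ + j) (Submodule.mem_iSup_of_mem (by simpa using hj)
      (hφ j m hm))
  have h0 : φ (Verma.hwVec 𝒢 lam) ∈ d.eigenspace μ := by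
    simpa using hφ 0 _ Verma.hwVec_mem_grading
  exact hv ((Submodule.disjoint_def.1 (d.eigenspaces_iSupIndep μ)) _ h0 h1)

theorem Irr.mem_grading {j : ℤ} {m : Irr 𝒢 lam} : m ∈ Irr.grading 𝒢 lam j ↔
    ∃ u ∈ envGrading 𝒢 j, orbit 𝔤 (Irr.hwVec 𝒢 lam) u = m := by
  have h : ∀ u, orbit 𝔤 (Irr.hwVec 𝒢 lam) u =
      LieSubmodule.Quotient.mk' (Verma.maxGraded 𝒢 lam) (Verma.proj 𝒢 lam u) := fun u => by
    rw [Verma.proj_eq_orbit, map_orbit, Irr.hwVec]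
  constructor
  · rintro ⟨_, ⟨u, hu, rfl⟩, rfl⟩
    exact ⟨u, hu, h u⟩
  · rintro ⟨u, hu, rfl⟩
    exact ⟨_, ⟨u, hu, rfl⟩, (h u).symm⟩

theorem Irr.lie_mem_grading {i j : ℤ} {x : 𝔤} (hx : x ∈ 𝒢 i) {m : Irr 𝒢 lam}
    (hm : m ∈ Irr.grading 𝒢 lam j) : ⁅x, m⁆ ∈ Irr.grading 𝒢 lam (i + j) := by
  rw [Irr.mem_grading] at hm ⊢
  obtain ⟨u, hu, rfl⟩ := hm
  exact ⟨_, ι_mul_mem_envGrading hx hu, orbit_ι_mul _ _ _⟩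

theorem Irr.hwVec_mem_grading : Irr.hwVec 𝒢 lam ∈ Irr.grading 𝒢 lam 0 :=
  Irr.mem_grading.2 ⟨1, one_mem_envGrading, orbit_one _⟩

theorem Irr.lie_hwVec_mem_grading {j : ℤ} {x : 𝔤} (hx : x ∈ 𝒢 j) :
    ⁅x, Irr.hwVec 𝒢 lam⁆ ∈ Irr.grading 𝒢 lam j := by
  have h := Irr.lie_mem_grading hx (Irr.hwVec_mem_grading (lam := lam))
  rwa [add_zero] at h

theorem Irr.isQuasifinite_of_finite_codim (h𝒢 : IsLieGrading 𝒢)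
    (T : ℤ → Submodule ℂ 𝔤) [∀ i, FiniteDimensional ℂ (T i)]
    (hT : ∀ i < 0, ∀ x ∈ 𝒢 i, ∃ t ∈ T i, x - t ∈ 𝒢 i ∧ ⁅x - t, Irr.hwVec 𝒢 lam⁆ = 0) :
    Irr.IsQuasifinite 𝒢 lam := by
  intro j
  have := finiteDimensional_words (S := Submodule.span ℂ {Irr.hwVec 𝒢 lam}) h𝒢 T
    (fun i hi x hx => by
      obtain ⟨t, ht, h1, h2⟩ := hT i hi x hx
      refine ⟨t, ht, h1, fun s hs => ?_⟩
      obtain ⟨c, rfl⟩ := Submodule.mem_span_singleton.1 hs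
      rw [lie_smul, h2, smul_zero]) j.natAbs j
  suffices h : Irr.grading 𝒢 lam j ≤ words 𝒢 (Submodule.span ℂ {Irr.hwVec 𝒢 lam}) j.natAbs j from
    Submodule.finiteDimensional_of_le h
  intro m hm
  obtain ⟨u, hu, rfl⟩ := Irr.mem_grading.1 hm
  exact Irr.isHighestWeight.orbit_mem_words h𝒢 hu

end Verma

end Graded

/-! ### Gradings by eigenspaces -/

section Eigen

variable {𝔤 : Type*} [LieRing 𝔤] [LieAlgebra ℂ 𝔤] {𝒢 : ℤ → Submodule ℂ 𝔤} {lam : 𝒢 0 →ₗ[ℂ] ℂ}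

/-- Eigenspaces for distinct eigenvalues are independent, so a sum lying in one of them has no image
in the others. -/
theorem map_component_eq_zero {V E : Type*} [AddCommGroup V] [Module ℂ V] [AddCommGroup E]
    [Module ℂ E] {M : ℤ → Submodule ℂ V} {φ : V →ₗ[ℂ] E} {d : Module.End ℂ E} {μ : ℂ}
    (hφ : ∀ j, ∀ m ∈ M j, φ m ∈ d.eigenspace (μ + j)) {m : ℤ →₀ V} (hm : ∀ j, m j ∈ M j) {k : ℤ}
    (hk : φ (∑ j ∈ m.support, m j) ∈ d.eigenspace (μ + k)) {j : ℤ} (hj : j ≠ k) : φ (m j) = 0 := by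
  by_cases hjs : j ∈ m.support
  swap
  · rw [Finsupp.notMem_support_iff.1 hjs, map_zero]
  refine Submodule.disjoint_def.1 (d.eigenspaces_iSupIndep (μ + j)) _ (hφ j _ (hm j)) ?_
  have h : φ (m j) = φ (∑ j ∈ m.support, m j) - ∑ i ∈ m.support.erase j, φ (m i) := by
    rw [map_sum, ← Finset.add_sum_erase _ _ hjs, add_sub_cancel_right]
  rw [h]
  refine Submodule.sub_mem _ ?_ (Submodule.sum_mem _ fun i hi => ?_)
  · exact Submodule.mem_iSup_of_mem (μ + k) (Submodule.mem_iSup_of_mem (by simpa using hj.symm) hk)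
  · exact Submodule.mem_iSup_of_mem (μ + i) (Submodule.mem_iSup_of_mem
      (by simpa using Finset.ne_of_mem_erase hi) (hφ i _ (hm i)))

theorem Verma.isGraded_of_ker (h𝒢 : IsLieGrading 𝒢) {E : Type*} [AddCommGroup E] [Module ℂ E]
    {φ : Verma 𝒢 lam →ₗ[ℂ] E} {d : Module.End ℂ E} {μ : ℂ}
    (hφ : ∀ j, ∀ m ∈ Verma.grading 𝒢 lam j, φ m ∈ d.eigenspace (μ + j))
    {N : LieSubmodule ℂ 𝔤 (Verma 𝒢 lam)} (hN : ∀ m, m ∈ N ↔ φ m = 0) :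
    Verma.IsGraded 𝒢 lam N := by
  intro m hm
  obtain ⟨m', hm', rfl⟩ := (Submodule.mem_iSup_iff_exists_finsupp _ _).1
    (h𝒢.iSup_grading (lam := lam) ▸ Submodule.mem_top (x := m))
  have h0 : φ (∑ j ∈ m'.support, m' j) = 0 := (hN _).1 hm
  refine Submodule.sum_mem _ fun j _ => Submodule.mem_iSup_of_mem j ⟨?_, hm' j⟩
  -- Zero lies in every eigenspace, so any index other than j serves as `k`.
  refine (hN _).2 (map_component_eq_zero hφ hm' (k := j + 1) ?_ (by omega))
  rw [h0]
  exact Submodule.zero_mem _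

/-- The operator `d` need not come from 𝔤. This matters for W_∞^{(n)} with n ≥ 2, which does not
contain D. -/
theorem orbit_mem_eigenspace {V : Type*} [AddCommGroup V] [Module ℂ V] [LieRingModule 𝔤 V]
    [LieModule ℂ 𝔤 V] {d : Module.End ℂ V}
    (hd : ∀ j, ∀ x ∈ 𝒢 j, ∀ w, d ⁅x, w⁆ = ⁅x, d w⁆ + (j : ℂ) • ⁅x, w⁆) {v : V} {μ : ℂ}
    (hv : d v = μ • v) {j : ℤ} {u : UniversalEnvelopingAlgebra ℂ 𝔤} (hu : u ∈ envGrading 𝒢 j) :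
    orbit 𝔤 v u ∈ d.eigenspace (μ + j) := by
  suffices h : envGrading 𝒢 j ≤ (d.eigenspace (μ + j)).comap (orbit 𝔤 v) from h hu
  clear hu
  refine Submodule.span_le.2 ?_
  rintro _ ⟨l, hl, rfl, rfl⟩
  simp only [SetLike.mem_coe, Submodule.mem_comap, Module.End.mem_eigenspace_iff]
  induction l with
  | nil => simpa using hv
  | cons p l ih =>
    simp only [List.map_cons, List.prod_cons, List.sum_cons, orbit_ι_mul]
    rw [hd p.1 p.2 (hl p (by simp)), ih fun q hq => hl q (by simp [hq]), lie_smul, ← add_smul]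
    push_cast
    ring_nf

/-- A representation with a nonzero highest weight vector shows that `M(lam) ≠ 0`. -/
theorem IsHighestWeight.verma_hwVec_ne_zero {V : Type*} [AddCommGroup V] [Module ℂ V]
    [LieRingModule 𝔤 V] [LieModule ℂ 𝔤 V] {v : V} (hv : IsHighestWeight 𝒢 lam v) (h : v ≠ 0) :
    Verma.hwVec 𝒢 lam ≠ 0 := by
  obtain ⟨φ, rfl⟩ := hv.exists_hom
  rintro h0
  exact h (by rw [h0, map_zero])

end Eigen

/-- If `ker φ ⊆ ker q`, then `q` factors through `φ` on each submodule of the range of `φ`. -/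
theorem exists_factor {𝔥 M N Q : Type*} [LieRing 𝔥] [LieAlgebra ℂ 𝔥] [AddCommGroup M]
    [Module ℂ M] [LieRingModule 𝔥 M] [AddCommGroup N] [Module ℂ N]
    [LieRingModule 𝔥 N] [AddCommGroup Q] [Module ℂ Q] [LieRingModule 𝔥 Q]
    (φ : M →ₗ⁅ℂ, 𝔥⁆ N) (q : M →ₗ⁅ℂ, 𝔥⁆ Q) (h : ∀ m, φ m = 0 → q m = 0)
    (S : LieSubmodule ℂ 𝔥 N) (hS : ∀ x ∈ S, ∃ m, φ m = x) :
    ∃ f : S →ₗ⁅ℂ, 𝔥⁆ Q, ∀ (x : S) (m : M), φ m = x → f x = q m := by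
  choose s hs using fun x : S => hS x x.2
  have key : ∀ (x : S) (m : M), φ m = x → q (s x) = q m := fun x m hm => by
    rw [← sub_eq_zero, ← map_sub]
    exact h _ (by rw [map_sub, hs, hm, sub_self])
  refine ⟨{
    toFun := fun x => q (s x)
    map_add' := fun x y => ?_
    map_smul' := fun c x => ?_
    map_lie' := fun {a x} => ?_ }, key⟩
  · rw [← map_add]
    exact key _ _ (by rw [map_add, hs, hs]; rfl)
  · rw [RingHom.id_apply, ← map_smul]
    exact key _ _ (by rw [map_smul, hs]; rfl)
  · exact (key ⁅a, x⁆ ⁅a, s x⁆ (by rw [LieModuleHom.map_lie, hs]; rfl)).trans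
      (LieModuleHom.map_lie _ _ _)

/-! ### The structure of `W_{1+∞}` -/

namespace W1

theorem mk_op_central (x : W1) : mk (op x) (central x) = x := rfl

@[simp] theorem central_mk (A : DiffOp) (c : ℂ) : central (mk A c) = c := rfl

theorem mk_add_mk (A B : DiffOp) (a b : ℂ) : mk A a + mk B b = mk (A + B) (a + b) := rfl

theorem smul_mk (c : ℂ) (A : DiffOp) (a : ℂ) : c • mk A a = mk (c • A) (c * a) := rfl

theorem mk_zero_zero : mk 0 0 = 0 := rfl

/-- The linear map `f ↦ t ^ r f(D)` into `W_{1+∞}`. -/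
def mono (r : ℤ) : ℂ[X] →ₗ[ℂ] W1 where
  toFun f := mk (DiffOp.mono r f) 0
  map_add' f g := by rw [map_add, mk_add_mk, add_zero]
  map_smul' c f := by rw [map_smul, RingHom.id_apply, smul_mk, mul_zero]

theorem mono_apply (r : ℤ) (f : ℂ[X]) : mono r f = mk (DiffOp.mono r f) 0 := rfl

theorem mem_grading {j : ℤ} {x : W1} : x ∈ grading j ↔
    (∃ f, DiffOp.mono j f = op x) ∧ (j ≠ 0 → central x = 0) := by
  rw [grading, Submodule.mem_inf]
  by_cases hj : j = 0 <;> simp [hj]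

theorem mem_grading_of_ne {j : ℤ} (hj : j ≠ 0) {x : W1} :
    x ∈ grading j ↔ ∃ f, mono j f = x := by
  rw [mem_grading]
  constructor
  · rintro ⟨⟨f, hf⟩, hc⟩
    exact ⟨f, by rw [mono_apply, hf, ← hc hj, mk_op_central]⟩
  · rintro ⟨f, rfl⟩
    exact ⟨⟨f, rfl⟩, fun _ => rfl⟩

theorem mem_grading_zero {x : W1} :
    x ∈ grading 0 ↔ ∃ f c, mk (DiffOp.mono 0 f) c = x := by
  rw [mem_grading]
  constructor
  · rintro ⟨⟨f, hf⟩, -⟩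
    exact ⟨f, central x, by rw [hf, mk_op_central]⟩
  · rintro ⟨f, c, rfl⟩
    exact ⟨⟨f, rfl⟩, fun h => absurd rfl h⟩

theorem mono_mem_grading (j : ℤ) (f : ℂ[X]) : mono j f ∈ grading j :=
  mem_grading.2 ⟨⟨f, rfl⟩, fun _ => rfl⟩

theorem lie_mk_mono (r s : ℤ) (f g : ℂ[X]) (a b : ℂ) :
    ⁅mk (DiffOp.mono r f) a, mk (DiffOp.mono s g) b⁆ =
      mk (DiffOp.mono (r + s) (f.comp (X + C (s : ℂ)) * g - g.comp (X + C (r : ℂ)) * f))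
        (DiffOp.psi (DiffOp.mono r f) (DiffOp.mono s g)) := by
  rw [lie_mk, DiffOp.mono_mul_mono, DiffOp.mono_mul_mono, map_sub, add_comm s r]

theorem psi_zero_left (s : ℤ) (f g : ℂ[X]) :
    DiffOp.psi (DiffOp.mono 0 f) (DiffOp.mono s g) = 0 := by
  rw [DiffOp.psi_mono]
  simp [DiffOp.orientedSum]

theorem lie_mono_of_ne {r s : ℤ} (h : r + s ≠ 0) (f g : ℂ[X]) : ⁅mono r f, mono s g⁆ =
    mono (r + s) (f.comp (X + C (s : ℂ)) * g - g.comp (X + C (r : ℂ)) * f) := by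
  rw [mono_apply, mono_apply, lie_mk_mono, DiffOp.psi_mono, if_neg h, mono_apply]

/-- Degree zero elements multiply g by a polynomial, so they preserve ideals of polynomials. -/
theorem lie_mk_zero_mono (s : ℤ) (f g : ℂ[X]) (a : ℂ) : ⁅mk (DiffOp.mono 0 f) a, mono s g⁆ =
    mono s (g * (f.comp (X + C (s : ℂ)) - f)) := by
  rw [mono_apply, lie_mk_mono, psi_zero_left, mono_apply, zero_add]
  congr 2
  simp; ring

/-- Both the operator and the central term depend only on the product f(D - 1) g(D), so polynomial
factors can be moved between the two arguments. -/
theorem lie_mono_one_mono_neg_one (f g : ℂ[X]) : ⁅mono 1 f, mono (-1) g⁆ =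
    mk (DiffOp.mono 0 (f.comp (X - 1) * g - (f.comp (X - 1) * g).comp (X + 1)))
      ((f.comp (X - 1) * g).eval 0) := by
  rw [mono_apply, mono_apply, lie_mk_mono, DiffOp.psi_mono_of_nonneg 1 (by norm_num)]
  congr 1
  · congr 1
    simp [mul_comp, comp_assoc, sub_eq_add_neg, mul_comm]
  · simp

theorem isLieGrading : IsLieGrading grading where
  lie_mem := by
    intro i j x y hx hy
    obtain ⟨⟨f, hf⟩, -⟩ := mem_grading.1 hx
    obtain ⟨⟨g, hg⟩, -⟩ := mem_grading.1 hy
    rw [← mk_op_central x, ← mk_op_central y, ← hf, ← hg, lie_mk_mono]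
    refine mem_grading.2 ⟨⟨_, rfl⟩, fun h => ?_⟩
    rw [central_mk, DiffOp.psi_mono, if_neg h]
  iSup_eq_top := by
    refine Submodule.eq_top_iff'.2 fun x => ?_
    rw [← mk_op_central x, ← add_zero (op x), ← zero_add (central x), ← mk_add_mk]
    refine Submodule.add_mem _ ?_ ?_
    · induction op x using DiffOp.induction with
      | h0 => exact Submodule.zero_mem _
      | hadd A B hA hB =>
        rw [← add_zero (0 : ℂ), ← mk_add_mk]
        exact Submodule.add_mem _ hA hB
      | hmono r f => exact Submodule.mem_iSup_of_mem r (mono_mem_grading r f)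
    · exact Submodule.mem_iSup_of_mem 0 (mem_grading_zero.2 ⟨0, central x, by rw [map_zero]⟩)

/-- The element `D`, which acts on `W_{1+∞}` by the degree. -/
def degreeElt : W1 := mono 0 X

theorem lie_degreeElt {j : ℤ} {x : W1} (hx : x ∈ grading j) : ⁅degreeElt, x⁆ = (j : ℂ) • x := by
  by_cases hj : j = 0
  · subst hj
    obtain ⟨f, c, rfl⟩ := mem_grading_zero.1 hx
    rw [degreeElt, mono_apply, lie_mk_mono, psi_zero_left]
    simp [mul_comm, mk_zero_zero]
  · obtain ⟨f, rfl⟩ := (mem_grading_of_ne hj).1 hx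
    rw [degreeElt, mono_apply 0, lie_mk_zero_mono, ← map_smul]
    congr 1
    simp [smul_eq_C_mul, mul_comm]

theorem lie_eq_zero_of_mem_grading_zero {x y : W1} (hx : x ∈ grading 0) (hy : y ∈ grading 0) :
    ⁅x, y⁆ = 0 := by
  obtain ⟨f, a, rfl⟩ := mem_grading_zero.1 hx
  obtain ⟨g, b, rfl⟩ := mem_grading_zero.1 hy
  rw [lie_mk_mono, psi_zero_left]
  simp [mul_comm, mk_zero_zero]

/-! ### Verma modules over `W_{1+∞}` do not vanish -/

theorem lie_mem_of_mem_iSup {s s' : ℤ → Prop} {N : Submodule ℂ W1}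
    (h : ∀ i j, s i → s' j → ∀ x ∈ grading i, ∀ y ∈ grading j, ⁅x, y⁆ ∈ N) {x y : W1}
    (hx : x ∈ ⨆ i, ⨆ _ : s i, grading i) (hy : y ∈ ⨆ i, ⨆ _ : s' i, grading i) : ⁅x, y⁆ ∈ N := by
  suffices h1 : (⨆ i, ⨆ _ : s i, grading i) ≤ N.comap ((act W1 W1).flip y) from h1 hx
  refine iSup₂_le fun i hi x hx => ?_
  suffices h2 : (⨆ i, ⨆ _ : s' i, grading i) ≤ N.comap (act W1 W1 x) from h2 hy
  exact iSup₂_le fun j hj y hy => h i j hi hj x hx y hy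

/-- The subalgebra of elements of negative degree. -/
def negative : LieSubalgebra ℂ W1 :=
  { (⨆ i, ⨆ _ : i < 0, grading i : Submodule ℂ W1) with
    lie_mem' := fun {x y} hx hy => by
      refine lie_mem_of_mem_iSup (s := fun i => i < 0) (s' := fun i => i < 0) ?_ hx hy
      intro i j hi hj x hx y hy
      exact Submodule.mem_iSup_of_mem (i + j) (Submodule.mem_iSup_of_mem (by omega)
        (isLieGrading.lie_mem hx hy)) }

/-- The part of negative degree of a differential operator. -/
def negPart : DiffOp →ₗ[ℂ] DiffOp := DiffOp.lift fun r => if r < 0 then DiffOp.mono r else 0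

theorem mk_negPart_mem (A : DiffOp) : mk (negPart A) 0 ∈ negative := by
  induction A using DiffOp.induction with
  | h0 => rw [map_zero]; exact negative.zero_mem
  | hadd A B hA hB =>
    rw [map_add, ← add_zero (0 : ℂ), ← mk_add_mk]
    exact negative.add_mem hA hB
  | hmono r f =>
    rw [negPart, DiffOp.lift_mono]
    split_ifs with hr
    · exact Submodule.mem_iSup_of_mem (p := fun i => ⨆ _ : i < 0, grading i) r
        (Submodule.mem_iSup_of_mem hr (mono_mem_grading r f))
    · exact negative.zero_mem

/-- The projection to the part of negative degree. -/
def projNeg : W1 →ₗ[ℂ] negative where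
  toFun x := ⟨mk (negPart (op x)) 0, mk_negPart_mem _⟩
  map_add' x y := Subtype.ext (by
    change mk (negPart (op (x + y))) 0 = mk _ 0 + mk _ 0
    rw [map_add, map_add, mk_add_mk, add_zero])
  map_smul' c x := Subtype.ext (by
    change mk (negPart (op (c • x))) 0 = c • mk _ 0
    rw [map_smul, map_smul, smul_mk, mul_zero])

theorem projNeg_of_neg {i : ℤ} (hi : i < 0) {x : W1} (hx : x ∈ grading i) :
    (projNeg x : W1) = x := by
  obtain ⟨f, rfl⟩ := (mem_grading_of_ne hi.ne).1 hx
  change mk (negPart (DiffOp.mono i f)) 0 = _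
  rw [negPart, DiffOp.lift_mono, if_pos hi, mono_apply]

theorem projNeg_of_nonneg {i : ℤ} (hi : 0 ≤ i) {x : W1} (hx : x ∈ grading i) :
    projNeg x = 0 := by
  obtain ⟨⟨f, hf⟩, -⟩ := mem_grading.1 hx
  refine Subtype.ext ?_
  change mk (negPart (op x)) 0 = _
  rw [← hf, negPart, DiffOp.lift_mono, if_neg (by omega)]
  rfl

theorem projNeg_coe (y : negative) : projNeg y = y := by
  suffices h : (⨆ i, ⨆ _ : i < 0, grading i : Submodule ℂ W1) ≤ LinearMap.eqLocus
      (negative.toSubmodule.subtype.comp projNeg) LinearMap.id from Subtype.ext (h y.2)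
  exact iSup₂_le fun i hi x hx => projNeg_of_neg hi hx

/-- The projection to the part of degree zero. -/
def projZero : W1 →ₗ[ℂ] grading 0 where
  toFun x := ⟨mk (DiffOp.mono 0 (DiffOp.coeff 0 (op x))) (central x),
    mem_grading_zero.2 ⟨_, _, rfl⟩⟩
  map_add' x y := Subtype.ext (by
    change mk (DiffOp.mono 0 (DiffOp.coeff 0 (op (x + y)))) (central (x + y)) = mk _ _ + mk _ _
    rw [map_add, map_add, map_add, map_add, mk_add_mk])
  map_smul' c x := Subtype.ext (by
    change mk (DiffOp.mono 0 (DiffOp.coeff 0 (op (c • x)))) (central (c • x)) = c • mk _ _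
    rw [map_smul, map_smul, map_smul, map_smul, smul_mk, smul_eq_mul])

theorem projZero_of_ne {i : ℤ} (hi : i ≠ 0) {x : W1} (hx : x ∈ grading i) : projZero x = 0 := by
  obtain ⟨f, rfl⟩ := (mem_grading_of_ne hi).1 hx
  refine Subtype.ext ?_
  change mk (DiffOp.mono 0 (DiffOp.coeff 0 (DiffOp.mono i f))) 0 = _
  rw [DiffOp.coeff_mono, if_neg hi, map_zero]
  rfl

theorem projZero_coe (x : grading 0) : projZero x = x := by
  obtain ⟨x, hx⟩ := x
  obtain ⟨f, c, rfl⟩ := mem_grading_zero.1 hx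
  refine Subtype.ext ?_
  change mk (DiffOp.mono 0 (DiffOp.coeff 0 (DiffOp.mono 0 f))) c = _
  rw [DiffOp.coeff_mono, if_pos rfl]

theorem projZero_coe_negative (y : negative) : projZero (y : W1) = 0 := by
  suffices h : (⨆ i, ⨆ _ : i < 0, grading i : Submodule ℂ W1) ≤ LinearMap.ker projZero from h y.2
  exact iSup₂_le fun i hi x hx => projZero_of_ne hi.ne hx

theorem mem_iSup_of_projNeg_eq_zero {x : W1} (hx : projNeg x = 0) :
    x ∈ ⨆ i, ⨆ _ : 0 ≤ i, grading i := by
  have h : ∀ y : W1, y - projNeg y ∈ ⨆ i, ⨆ _ : 0 ≤ i, grading i := by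
    suffices h : (⊤ : Submodule ℂ W1) ≤ (⨆ i, ⨆ _ : 0 ≤ i, grading i).comap
      (LinearMap.id - negative.toSubmodule.subtype.comp projNeg) from fun y => h Submodule.mem_top
    rw [← isLieGrading.iSup_eq_top]
    refine iSup_le fun i y hy => ?_
    change y - (projNeg y : W1) ∈ ⨆ i, ⨆ _ : 0 ≤ i, grading i
    rcases lt_or_ge i 0 with hi | hi
    · rw [projNeg_of_neg hi hy, sub_self]
      exact Submodule.zero_mem _
    · rw [projNeg_of_nonneg hi hy]
      exact Submodule.mem_iSup_of_mem i (Submodule.mem_iSup_of_mem hi (by simpa using hy))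
  simpa [hx] using h x

variable (lam : grading 0 →ₗ[ℂ] ℂ)

attribute [local instance 100] LieRing.ofAssociativeRing in
-- U(𝔫), with 𝔫 the negative part, carries a representation whose vector 1 is a nonzero highest
-- weight vector of weight `lam`.
theorem verma_hwVec_ne_zero : Verma.hwVec grading lam ≠ 0 := by
  -- For elements of nonnegative degree, a bracket has degree zero only if both do, and 𝔤_0 is
  -- commutative; hence `lam`, extended by zero, is a character.
  have hb : ∀ x x', projNeg x = 0 → projNeg x' = 0 → ⁅x, x'⁆ ∈
      LinearMap.ker projNeg ⊓ LinearMap.ker projZero := by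
    intro x x' hx hx'
    refine lie_mem_of_mem_iSup (s := fun i => 0 ≤ i) (s' := fun i => 0 ≤ i) ?_
      (mem_iSup_of_projNeg_eq_zero hx) (mem_iSup_of_projNeg_eq_zero hx')
    intro i j hi hj x hx y hy
    have hxy := isLieGrading.lie_mem hx hy
    refine ⟨projNeg_of_nonneg (by omega) hxy, ?_⟩
    rcases eq_or_ne (i + j) 0 with h | h
    · obtain rfl : i = 0 := by omega
      obtain rfl : j = 0 := by omega
      rw [lie_eq_zero_of_mem_grading_zero hx hy]
      exact Submodule.zero_mem _
    · exact projZero_of_ne h hxy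
  obtain ⟨ρ, hρ⟩ := exists_induced projNeg (lam.comp projZero) projNeg_coe
    (fun y => by rw [LinearMap.comp_apply, projZero_coe_negative, map_zero])
    (fun x x' hx hx' => (hb x x' hx hx').1)
    (fun x x' hx hx' => by
      rw [LinearMap.comp_apply, LinearMap.mem_ker.1 (hb x x' hx hx').2, map_zero])
  let _ : LieRingModule W1 (UniversalEnvelopingAlgebra ℂ negative) :=
    { bracket := fun x u => ρ x u
      add_lie := fun x y u => by rw [map_add, LinearMap.add_apply]
      lie_add := fun x u u' => map_add _ _ _
      leibniz_lie := fun x y u => by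
        have := congrArg (fun T => T u) (ρ.map_lie' (x := x) (y := y))
        change ρ x (ρ y u) = ρ ⁅x, y⁆ u + ρ y (ρ x u)
        change ρ ⁅x, y⁆ u = ρ x (ρ y u) - ρ y (ρ x u) at this
        rw [this, sub_add_cancel] }
  have : LieModule ℂ W1 (UniversalEnvelopingAlgebra ℂ negative) :=
    { smul_lie := fun c x u => by
        change ρ (c • x) u = c • ρ x u
        rw [map_smul, LinearMap.smul_apply]
      lie_smul := fun c x u => map_smul _ _ _ }
  refine IsHighestWeight.verma_hwVec_ne_zero
    (v := (1 : UniversalEnvelopingAlgebra ℂ negative)) ⟨fun h => ?_, fun i hi x hx => ?_⟩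
    (env_one_ne_zero _)
  · change ρ h 1 = _
    rw [hρ _ (projNeg_of_nonneg le_rfl h.2), LinearMap.comp_apply, projZero_coe,
      Algebra.algebraMap_eq_smul_one]
  · change ρ x 1 = 0
    rw [hρ _ (projNeg_of_nonneg (le_of_lt hi) hx), LinearMap.comp_apply,
      projZero_of_ne (ne_of_gt hi) hx, map_zero, map_zero]

end W1

namespace W1

variable (lam : grading 0 →ₗ[ℂ] ℂ)

/-! ### The degree operator on modules over `W_{1+∞}` -/

section Degree

variable {V : Type*} [AddCommGroup V] [Module ℂ V] [LieRingModule W1 V] [LieModule ℂ W1 V]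

theorem degreeElt_lie_lie {j : ℤ} {x : W1} (hx : x ∈ grading j) (w : V) :
    LieModule.toEnd ℂ W1 V degreeElt ⁅x, w⁆ =
      ⁅x, LieModule.toEnd ℂ W1 V degreeElt w⁆ + (j : ℂ) • ⁅x, w⁆ := by
  simp only [LieModule.toEnd_apply_apply]
  rw [leibniz_lie, lie_degreeElt hx, smul_lie, add_comm]

variable {lam}

theorem degreeElt_highestWeight {v : V} (hv : IsHighestWeight grading lam v) :
    LieModule.toEnd ℂ W1 V degreeElt v = lam ⟨degreeElt, mono_mem_grading 0 X⟩ • v :=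
  hv.weight ⟨degreeElt, mono_mem_grading 0 X⟩

theorem orbit_mem_eigenspace {v : V} (hv : IsHighestWeight grading lam v) {j : ℤ}
    {u : UniversalEnvelopingAlgebra ℂ W1} (hu : u ∈ envGrading grading j) :
    orbit W1 v u ∈ (LieModule.toEnd ℂ W1 V degreeElt).eigenspace
      (lam ⟨degreeElt, mono_mem_grading 0 X⟩ + j) :=
  WInfinity.orbit_mem_eigenspace (fun _ _ hx w => degreeElt_lie_lie hx w)
    (degreeElt_highestWeight hv) hu

theorem irr_grading_le {j : ℤ} : Irr.grading grading lam j ≤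
    (LieModule.toEnd ℂ W1 (Irr grading lam) degreeElt).eigenspace
      (lam ⟨degreeElt, mono_mem_grading 0 X⟩ + j) := by
  intro m hm
  obtain ⟨u, hu, rfl⟩ := Irr.mem_grading.1 hm
  exact orbit_mem_eigenspace Irr.isHighestWeight hu

end Degree

theorem irr_hwVec_ne_zero : Irr.hwVec grading lam ≠ 0 :=
  Irr.hwVec_ne_zero isLieGrading LinearMap.id (LieModule.toEnd ℂ W1 _ degreeElt)
    (lam ⟨degreeElt, mono_mem_grading 0 X⟩)
    (by
      rintro j _ ⟨u, hu, rfl⟩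
      rw [LinearMap.id_apply, Verma.proj_eq_orbit]
      exact orbit_mem_eigenspace Verma.isHighestWeight hu)
    (verma_hwVec_ne_zero lam)

variable {lam}

/-- A submodule of `L(lam)` that does not contain the highest weight vector vanishes. -/
theorem irr_eq_zero_of_mem {N : LieSubmodule ℂ W1 (Irr grading lam)}
    (hN : Irr.hwVec grading lam ∉ N) {m : Irr grading lam} (hm : m ∈ N) : m = 0 := by
  obtain ⟨m, rfl⟩ := LieSubmodule.Quotient.surjective_mk' _ m
  let N' := N.comap (LieSubmodule.Quotient.mk' (Verma.maxGraded grading lam))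
  -- Gradedness is automatic: D acts on M(lam)/N' with a different eigenvalue for each degree.
  have hgr : Verma.IsGraded grading lam N' :=
    Verma.isGraded_of_ker isLieGrading
      (φ := (LieSubmodule.Quotient.mk' N' : Verma grading lam →ₗ[ℂ] Verma grading lam ⧸ N'))
      (d := LieModule.toEnd ℂ W1 (Verma grading lam ⧸ N') degreeElt)
      (μ := lam ⟨degreeElt, mono_mem_grading 0 X⟩)
      (by
        rintro j _ ⟨u, hu, rfl⟩
        rw [Verma.proj_eq_orbit, LieModuleHom.coe_toLinearMap, map_orbit]
        exact orbit_mem_eigenspace (Verma.isHighestWeight.map _) hu)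
      (fun m => (LieSubmodule.Quotient.mk_eq_zero N').symm)
  have hle : N' ≤ Verma.maxGraded grading lam := by
    refine le_sSup ⟨hgr, fun h => hN ?_⟩
    have : Verma.hwVec grading lam ∈ N' := h ▸ LieSubmodule.mem_top _
    exact this
  exact (LieSubmodule.Quotient.mk_eq_zero _).2 (hle hm)

/-! ### Quasifiniteness over `W_{1+∞}` -/

/-- If `lam` kills the brackets of `𝔤_1` with all `t⁻¹ b(D) g(D)`, then these elements kill the
highest weight vector of `L(lam)`. -/
theorem lie_hwVec_of_brackets {b : ℂ[X]}
    (hb : ∀ f g : ℂ[X], ⁅⁅mono 1 f, mono (-1) (b * g)⁆, Irr.hwVec grading lam⁆ = 0) (g : ℂ[X]) :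
    ⁅mono (-1) (b * g), Irr.hwVec grading lam⁆ = 0 := by
  set v := Irr.hwVec grading lam with hv
  have hw : IsHighestWeight grading lam v := Irr.isHighestWeight
  let S : Submodule ℂ (Irr grading lam) := LinearMap.range
    (((act W1 (Irr grading lam)).flip v).comp ((mono (-1)).comp (LinearMap.mulLeft ℂ b)))
  have hS : ∀ s, s ∈ S ↔ ∃ g, ⁅mono (-1) (b * g), v⁆ = s := fun s => Iff.rfl
  have h0 : ∀ x ∈ grading 0, ∀ s ∈ S, ⁅x, s⁆ ∈ S := by
    rintro x hx s hs
    obtain ⟨g, rfl⟩ := (hS s).1 hs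
    obtain ⟨f, c, rfl⟩ := mem_grading_zero.1 hx
    rw [leibniz_lie, lie_mk_zero_mono, hw.weight ⟨_, hx⟩, lie_smul, mul_assoc]
    exact S.add_mem ((hS _).2 ⟨_, rfl⟩) (S.smul_mem _ hs)
  -- The hypothesis settles degree 1. For i ≥ 2 the bracket with t⁻¹ b(D) g(D) still has positive
  -- degree and kills v.
  have hpos : ∀ i > 0, ∀ x ∈ grading i, ∀ s ∈ S, ⁅x, s⁆ = 0 := by
    rintro i hi x hx s hs
    obtain ⟨g, rfl⟩ := (hS s).1 hs
    rw [leibniz_lie, hw.pos i hi x hx, lie_zero, add_zero]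
    rcases eq_or_ne i 1 with rfl | h1
    · obtain ⟨f, rfl⟩ := (mem_grading_of_ne one_ne_zero).1 hx
      exact hb f g
    · exact hw.pos (i + -1) (by omega) _ (isLieGrading.lie_mem hx (mono_mem_grading _ _))
  have hSgr : S ≤ Irr.grading grading lam (-1) := by
    intro s hs
    obtain ⟨g, rfl⟩ := (hS s).1 hs
    exact Irr.lie_hwVec_mem_grading (mono_mem_grading _ _)
  have hwords : ∀ r j, words grading S r j ≤ Irr.grading grading lam (j - 1) := by
    intro r
    induction r with
    | zero =>
      intro j
      by_cases hj : j = 0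
      · subst hj
        rw [words, if_pos rfl]
        exact hSgr
      · rw [words, if_neg hj]
        exact bot_le
    | succ r ih =>
      intro j
      refine words_succ_le (ih j) fun i k _ hik y hy w hw => ?_
      subst hik
      rw [add_sub_assoc]
      exact Irr.lie_mem_grading hy (ih k hw)
  refine irr_eq_zero_of_mem (N := wordsSubmodule isLieGrading h0 hpos) (fun hmem => ?_)
    (le_wordsSubmodule isLieGrading h0 hpos ((hS _).2 ⟨g, rfl⟩))
  -- `S` sits in degree -1, so words on it have degree j - 1 < 0, and D never has the eigenvalue of
  -- v on them.
  have hlt : (⨆ r, ⨆ j, words grading S r j) ≤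
      ⨆ c : ℂ, ⨆ _ : c ≠ lam ⟨degreeElt, mono_mem_grading 0 X⟩,
        (LieModule.toEnd ℂ W1 (Irr grading lam) degreeElt).eigenspace c := by
    refine iSup₂_le fun r j => ?_
    rcases lt_or_ge 0 j with hj | hj
    · rw [words_eq_bot r hj]
      exact bot_le
    · refine (hwords r j).trans (irr_grading_le.trans (le_iSup₂_of_le _ ?_ le_rfl))
      rw [Ne, add_eq_left, Int.cast_eq_zero]
      omega
  exact irr_hwVec_ne_zero lam (Submodule.disjoint_def.1
    ((LieModule.toEnd ℂ W1 (Irr grading lam) degreeElt).eigenspaces_iSupIndep _) _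
    (Module.End.mem_eigenspace_iff.2 (degreeElt_highestWeight hw)) (hlt hmem))

theorem comp_X_add_C_ne_zero {p : ℂ[X]} (hp : p ≠ 0) (c : ℂ) : p.comp (X + C c) ≠ 0 := by
  rwa [Ne, ← taylor_apply, taylor_eq_zero]

/-- If the `t⁻¹ b(D) g(D)` kill `v`, each degree has a nonzero ideal of polynomials with this
property. -/
theorem exists_killing_ideal {V : Type*} [AddCommGroup V] [Module ℂ V] [LieRingModule W1 V]
    [LieModule ℂ W1 V] {v : V} {b : ℂ[X]} (hb0 : b ≠ 0)
    (hb : ∀ g, ⁅mono (-1) (b * g), v⁆ = 0) (k : ℕ) :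
    ∃ a : ℂ[X], a ≠ 0 ∧ ∀ g, ⁅mono (-(k + 1)) (a * g), v⁆ = 0 := by
  induction k with
  | zero => exact ⟨b, hb0, by simpa using hb⟩
  | succ k ih =>
    obtain ⟨a, ha0, ha⟩ := ih
    refine ⟨b.comp (X + C ((-(k + 1) : ℤ) : ℂ)) * a,
      mul_ne_zero (comp_X_add_C_ne_zero hb0 _) ha0, fun h => ?_⟩
    have key : ∀ g g', ⁅mono (-1 + -(k + 1)) ((b * g).comp (X + C ((-(k + 1) : ℤ) : ℂ)) * (a * g') -
        (a * g').comp (X + C ((-1 : ℤ) : ℂ)) * (b * g)), v⁆ = 0 := by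
      intro g g'
      rw [← lie_mono_of_ne (by omega), lie_lie, hb, ha, lie_zero, lie_zero, sub_zero]
    -- Let E(g, g') be the polynomial in `key`. In E(1, Xh) - E(X, h) the first product of E(1, h)
    -- appears k + 1 times, and the second once with the opposite sign; adding E(1, h) leaves k + 2
    -- copies of the first.
    have e : mono (-((k + 1 : ℕ) + 1)) (b.comp (X + C ((-(k + 1) : ℤ) : ℂ)) * a * h) =
        ((k : ℂ) + 2)⁻¹ • (mono (-1 + -(k + 1)) ((b * 1).comp (X + C ((-(k + 1) : ℤ) : ℂ)) *
            (a * h) - (a * h).comp (X + C ((-1 : ℤ) : ℂ)) * (b * 1)) -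
          mono (-1 + -(k + 1)) ((b * X).comp (X + C ((-(k + 1) : ℤ) : ℂ)) * (a * h) -
            (a * h).comp (X + C ((-1 : ℤ) : ℂ)) * (b * X)) +
          mono (-1 + -(k + 1)) ((b * 1).comp (X + C ((-(k + 1) : ℤ) : ℂ)) * (a * (X * h)) -
            (a * (X * h)).comp (X + C ((-1 : ℤ) : ℂ)) * (b * 1))) := by
      have hk : (k : ℂ) + 2 ≠ 0 := by exact_mod_cast (by omega : k + 2 ≠ 0)
      rw [eq_inv_smul_iff₀ hk, ← map_sub, ← map_add, ← map_smul]
      have hd : -(((k + 1 : ℕ) : ℤ) + 1) = -1 + -((k : ℤ) + 1) := by push_cast; ring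
      rw [hd]
      congr 1
      simp only [mul_comp, X_comp, one_comp, smul_eq_C_mul, map_add, map_neg, Int.cast_neg,
        Int.cast_add, Int.cast_natCast, Int.cast_one, map_one, map_natCast, map_ofNat]
      ring
    rw [e, smul_lie, add_lie, sub_lie, key, key, key, sub_zero, add_zero, smul_zero]

/-- Divide with remainder in each degree: multiples of the killing polynomial act by zero on v, and
the remainders form a finite dimensional space. -/
theorem isQuasifinite_of_killing {b : ℂ[X]} (hb0 : b ≠ 0)
    (hb : ∀ g, ⁅mono (-1) (b * g), Irr.hwVec grading lam⁆ = 0) : Irr.IsQuasifinite grading lam := by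
  -- The polynomial `a k` belongs to degree -(k + 1), whence the index `i.natAbs - 1` for i < 0.
  choose a ha0 ha using exists_killing_ideal hb0 hb
  have : ∀ i : ℤ, FiniteDimensional ℂ ((degreeLT ℂ (a (i.natAbs - 1)).natDegree).map (mono i)) :=
    fun i => by
      have : FiniteDimensional ℂ (degreeLT ℂ (a (i.natAbs - 1)).natDegree) :=
        Module.Finite.equiv (degreeLTEquiv ℂ _).symm
      infer_instance
  refine Irr.isQuasifinite_of_finite_codim isLieGrading
    (fun i => (degreeLT ℂ (a (i.natAbs - 1)).natDegree).map (mono i)) fun i hi x hx => ?_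
  obtain ⟨f, rfl⟩ := (mem_grading_of_ne hi.ne).1 hx
  refine ⟨mono i (f % a (i.natAbs - 1)), ⟨_, ?_, rfl⟩, ?_, ?_⟩
  · refine mem_degreeLT.2 ?_
    rw [← degree_eq_natDegree (ha0 _)]
    exact EuclideanDomain.mod_lt f (ha0 _)
  · rw [← map_sub]
    exact mono_mem_grading _ _
  · have hi' : i = -(((i.natAbs - 1 : ℕ) : ℤ) + 1) := by omega
    have e : f - f % a (i.natAbs - 1) = a (i.natAbs - 1) * (f / a (i.natAbs - 1)) := by
      rw [sub_eq_iff_eq_add, EuclideanDomain.div_add_mod]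
    rw [← map_sub, e]
    have h := ha (i.natAbs - 1) (f / a (i.natAbs - 1))
    rwa [← hi'] at h

end W1

/-! ### The structure of `W_∞^{(n)}` -/

namespace Winf

/-- `∂_t ^ n = t ^ (-n) [D]_n`, where `[D]_n = D (D - 1) ⋯ (D - n + 1)`. -/
theorem partialT_pow (n : ℕ) :
    DiffOp.partialT ^ n = DiffOp.mono (-n) (descPochhammer ℂ n) := by
  induction n with
  | zero => simp [DiffOp.one_def]
  | succ n ih =>
    rw [pow_succ, ih, DiffOp.partialT, DiffOp.mono_mul_mono, descPochhammer_succ_left]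
    congr 1
    · congr 1; omega
    · simp [sub_eq_add_neg, mul_comm]

variable {n : ℕ}

theorem mono_mem (r : ℤ) (f : ℂ[X]) : W1.mono r (f * descPochhammer ℂ n) ∈ Winf n := by
  -- Moving f past t ^ (-n) shifts its argument by -n, which f(D + n) compensates.
  refine (DiffOp.mem_order n _).2 ⟨DiffOp.mono (r + n) (f.comp (X + C (n : ℂ))), ?_⟩
  change _ = DiffOp.mono r (f * descPochhammer ℂ n)
  rw [partialT_pow, DiffOp.mono_mul_mono]
  congr 1
  · congr 1; omega
  · simp [comp_assoc]

/-- The linear map `f ↦ t ^ r f(D) [D]_n` into `W_∞^{(n)}`. -/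
def mono (n : ℕ) (r : ℤ) : ℂ[X] →ₗ[ℂ] Winf n :=
  LinearMap.codRestrict (Winf n).toSubmodule
    ((W1.mono r).comp (LinearMap.mulRight ℂ (descPochhammer ℂ n))) fun f => mono_mem r f

theorem mono_mem_grading (r : ℤ) (f : ℂ[X]) : mono n r f ∈ grading n r :=
  W1.mono_mem_grading r _

theorem isLieGrading (n : ℕ) : IsLieGrading (grading n) where
  lie_mem := fun hx hy => W1.isLieGrading.lie_mem (x := _) hx hy
  iSup_eq_top := by
    refine Submodule.eq_top_iff'.2 ?_
    rintro ⟨x, hx⟩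
    obtain ⟨B, hB⟩ := (DiffOp.mem_order n _).1 hx
    have key : ∀ B : DiffOp, ∀ h : W1.mk (B * DiffOp.partialT ^ n) 0 ∈ Winf n,
        (⟨W1.mk (B * DiffOp.partialT ^ n) 0, h⟩ : Winf n) ∈ ⨆ j, grading n j := by
      intro B
      induction B using DiffOp.induction with
      | h0 =>
        intro h
        convert Submodule.zero_mem _
        rw [zero_mul]; rfl
      | hadd A B hA hB =>
        intro h
        have hA' : W1.mk (A * DiffOp.partialT ^ n) 0 ∈ Winf n := ⟨A, rfl⟩
        have hB' : W1.mk (B * DiffOp.partialT ^ n) 0 ∈ Winf n := ⟨B, rfl⟩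
        have e : (⟨_, h⟩ : Winf n) = ⟨_, hA'⟩ + ⟨_, hB'⟩ := Subtype.ext (by
          change W1.mk _ 0 = W1.mk _ 0 + W1.mk _ 0
          rw [add_mul, W1.mk_add_mk, add_zero])
        rw [e]
        exact Submodule.add_mem _ (hA hA') (hB hB')
      | hmono r f =>
        intro h
        refine Submodule.mem_iSup_of_mem (r + -n) ?_
        change W1.mk _ 0 ∈ W1.grading _
        rw [partialT_pow, DiffOp.mono_mul_mono]
        exact W1.mono_mem_grading _ _
    have hc : ∀ c, W1.mk 0 c ∈ Winf n := fun c => ⟨0, zero_mul _⟩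
    have hc' : (⟨W1.mk 0 (W1.central x), hc _⟩ : Winf n) ∈ ⨆ j, grading n j :=
      Submodule.mem_iSup_of_mem 0 (W1.mem_grading_zero.2 ⟨0, W1.central x, by rw [map_zero]; rfl⟩)
    have e : (⟨x, hx⟩ : Winf n) = ⟨_, ⟨B, rfl⟩⟩ + ⟨W1.mk 0 (W1.central x), hc _⟩ := Subtype.ext (by
      change x = W1.mk (B * DiffOp.partialT ^ n) 0 + W1.mk 0 _
      rw [hB, W1.mk_add_mk, add_zero, zero_add]
      rfl)
    rw [e]
    exact Submodule.add_mem _ (key B ⟨B, rfl⟩) hc'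

/-! ### Restriction of highest weight modules to W_∞^{(n)} -/

section Restriction

variable {lam : grading n 0 →ₗ[ℂ] ℂ} {lamt : W1.grading 0 →ₗ[ℂ] ℂ}
  {V : Type*} [AddCommGroup V] [Module ℂ V] [LieRingModule W1 V] [LieModule ℂ W1 V]

omit [LieModule ℂ W1 V] in
theorem isHighestWeight_of_restrict
    (hres : ∀ h : grading n 0, lamt ⟨((h : Winf n) : W1), h.2⟩ = lam h) {v : V}
    (hv : IsHighestWeight W1.grading lamt v) : IsHighestWeight (grading n) lam v where
  weight h := by
    rw [← hres h]
    exact hv.weight ⟨((h : Winf n) : W1), h.2⟩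
  pos i hi x hx := hv.pos i hi x hx

/-- The target is a module over all of W_{1+∞}, so D is available there to detect degrees. -/
theorem hom_mem_eigenspace {v : V} (hv : IsHighestWeight W1.grading lamt v)
    (φ : Verma (grading n) lam →ₗ⁅ℂ, Winf n⁆ V) (hφ : φ (Verma.hwVec (grading n) lam) = v) (j : ℤ)
    (m : Verma (grading n) lam) (hm : m ∈ Verma.grading (grading n) lam j) :
    φ m ∈ (LieModule.toEnd ℂ W1 V W1.degreeElt).eigenspace
      (lamt ⟨W1.degreeElt, W1.mono_mem_grading 0 X⟩ + j) := by
  obtain ⟨u, hu, rfl⟩ := hm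
  rw [Verma.proj_eq_orbit, map_orbit, hφ]
  exact orbit_mem_eigenspace (𝒢 := grading n) (fun _ x hx w => W1.degreeElt_lie_lie (x := x) hx w)
    (W1.degreeElt_highestWeight hv) hu

/-- Nonvanishing is inherited from W_{1+∞}, through the map M(lam) → M(lamt). -/
theorem irr_hwVec_ne_zero
    (hres : ∀ h : grading n 0, lamt ⟨((h : Winf n) : W1), h.2⟩ = lam h) :
    Irr.hwVec (grading n) lam ≠ 0 := by
  have hv := Verma.isHighestWeight (𝒢 := W1.grading) (lam := lamt)
  obtain ⟨φ, hφ⟩ := (isHighestWeight_of_restrict hres hv).exists_hom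
  refine Irr.hwVec_ne_zero (isLieGrading n) (φ : Verma (grading n) lam →ₗ[ℂ] Verma W1.grading lamt) _ _
    (hom_mem_eigenspace hv φ hφ) ?_
  rw [LieModuleHom.coe_toLinearMap, hφ]
  exact W1.verma_hwVec_ne_zero lamt

end Restriction

/-! ### Extension of weights and transfer of quasifiniteness -/

theorem exists_extension (lam : grading n 0 →ₗ[ℂ] ℂ) : ∃ lamt : W1.grading 0 →ₗ[ℂ] ℂ,
    ∀ h : grading n 0, lamt ⟨((h : Winf n) : W1), h.2⟩ = lam h := by
  let incl : grading n 0 →ₗ[ℂ] W1.grading 0 := LinearMap.codRestrict _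
    ((Winf n).toSubmodule.subtype.comp (grading n 0).subtype) fun h => h.2
  have hincl : LinearMap.ker incl = ⊥ := by
    refine LinearMap.ker_eq_bot.2 fun x y h => Subtype.ext (Subtype.ext ?_)
    exact congrArg (fun z : W1.grading 0 => (z : W1)) h
  obtain ⟨s, hs⟩ := incl.exists_leftInverse_of_injective hincl
  refine ⟨lam.comp s, fun h => ?_⟩
  exact congrArg lam (LinearMap.congr_fun hs h)

/-- A quasifinite `L(lam)` has a nonzero element `t⁻¹ g(D) [D]_n` that kills its highest weight
vector. -/
theorem exists_killing {lam : grading n 0 →ₗ[ℂ] ℂ} (hlam : Irr.IsQuasifinite (grading n) lam) :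
    ∃ g : ℂ[X], g ≠ 0 ∧ ⁅mono n (-1) g, Irr.hwVec (grading n) lam⁆ = 0 := by
  by_contra! hcon
  have := hlam (-1)
  let ψ : ℂ[X] →ₗ[ℂ] Irr.grading (grading n) lam (-1) := LinearMap.codRestrict _
    (((act (Winf n) (Irr (grading n) lam)).flip (Irr.hwVec (grading n) lam)).comp (mono n (-1)))
    fun f => Irr.lie_hwVec_mem_grading (mono_mem_grading _ _)
  have hψ : Function.Injective ψ := by
    refine (injective_iff_map_eq_zero ψ).2 fun f hf => ?_
    by_contra h
    exact hcon f h (congrArg Subtype.val hf)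
  exact Polynomial.not_finite (R := ℂ) (Module.Finite.of_injective ψ hψ)

/-- If `L(lam)` is quasifinite, then so is `L(lamt)` for each extension `lamt` of `lam`. -/
theorem isQuasifinite_extension {lam : grading n 0 →ₗ[ℂ] ℂ} {lamt : W1.grading 0 →ₗ[ℂ] ℂ}
    (hres : ∀ h : grading n 0, lamt ⟨((h : Winf n) : W1), h.2⟩ = lam h)
    (hlam : Irr.IsQuasifinite (grading n) lam) : Irr.IsQuasifinite W1.grading lamt := by
  obtain ⟨g₀, hg₀, hkill⟩ := exists_killing hlam
  have hw : IsHighestWeight (grading n) lam (Irr.hwVec (grading n) lam) := Irr.isHighestWeight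
  have hP : descPochhammer ℂ n ≠ 0 := (monic_descPochhammer ℂ n).ne_zero
  -- In L(lam) this bracket acts on v by the scalar lam, and also by zero because both factors kill
  -- v ≠ 0.
  have hbr : ∀ f, ∀ h : ⁅W1.mono 1 (f * descPochhammer ℂ n),
      W1.mono (-1) (g₀ * descPochhammer ℂ n)⁆ ∈ W1.grading 0, lamt ⟨_, h⟩ = 0 := by
    intro f h
    have hmem : ⁅mono n 1 f, mono n (-1) g₀⁆ ∈ grading n 0 :=
      (isLieGrading n).lie_mem_of_eq (add_neg_cancel 1) (mono_mem_grading 1 f) (mono_mem_grading (-1) g₀)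
    have h1 := hw.weight ⟨_, hmem⟩
    rw [lie_lie, hkill, hw.pos 1 one_pos _ (mono_mem_grading 1 f), lie_zero, lie_zero,
      sub_zero] at h1
    have h2 := (smul_eq_zero.1 h1.symm).resolve_right (irr_hwVec_ne_zero hres)
    rw [← h2, ← hres]
    rfl
  set P := descPochhammer ℂ n
  -- The factor P(D - 1) turns an arbitrary f(D - 1) into (f P)(D - 1), so that the degree 1
  -- argument lands in W_∞^{(n)}. The cofactor g moves to the same side as g(D + 1).
  refine W1.isQuasifinite_of_killing (b := P.comp (X + C (-1)) * (g₀ * P))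
    (mul_ne_zero (W1.comp_X_add_C_ne_zero hP _) (mul_ne_zero hg₀ hP))
    (W1.lie_hwVec_of_brackets fun f g => ?_)
  have e : ⁅W1.mono 1 f, W1.mono (-1) (P.comp (X + C (-1)) * (g₀ * P) * g)⁆ =
      ⁅W1.mono 1 (f * g.comp (X + 1) * P), W1.mono (-1) (g₀ * P)⁆ := by
    have : f.comp (X - 1) * (P.comp (X + C (-1)) * (g₀ * P) * g) =
        (f * g.comp (X + 1) * P).comp (X - 1) * (g₀ * P) := by
      simp only [mul_comp, comp_assoc, add_comp, X_comp, one_comp, comp_X, map_neg,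
        map_one, sub_eq_add_neg, neg_add_cancel_right]
      ring
    rw [W1.lie_mono_one_mono_neg_one, W1.lie_mono_one_mono_neg_one, this]
  have hmem : ⁅W1.mono 1 (f * g.comp (X + 1) * P), W1.mono (-1) (g₀ * P)⁆ ∈ W1.grading 0 :=
    W1.isLieGrading.lie_mem_of_eq (add_neg_cancel 1) (W1.mono_mem_grading 1 _) (W1.mono_mem_grading (-1) _)
  have h3 := (Irr.isHighestWeight (𝒢 := W1.grading) (lam := lamt)).weight ⟨_, hmem⟩
  rw [e]
  rw [hbr (f * g.comp (X + 1)) hmem, zero_smul] at h3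
  exact h3

end Winf

end WInfinity

end

/-! ### The quotient map onto L(lam) -/

theorem proposition4p10 (n : ℕ) (lam : WInfinity.Winf.grading n 0 →ₗ[ℂ] ℂ)
    (hlam : WInfinity.Irr.IsQuasifinite (WInfinity.Winf.grading n) lam) :
    ∃ lamt : WInfinity.W1.grading 0 →ₗ[ℂ] ℂ,
      (∀ h : WInfinity.Winf.grading n 0,
        lamt ⟨((h : WInfinity.Winf n) : WInfinity.W1), h.2⟩ = lam h) ∧
      WInfinity.Irr.IsQuasifinite WInfinity.W1.grading lamt ∧
      ∃ f : LieSubmodule.lieSpan ℂ (WInfinity.Winf n)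
            {WInfinity.Irr.hwVec WInfinity.W1.grading lamt} →ₗ⁅ℂ, WInfinity.Winf n⁆
          WInfinity.Irr (WInfinity.Winf.grading n) lam,
        Function.Surjective f ∧
        f ⟨WInfinity.Irr.hwVec WInfinity.W1.grading lamt,
            LieSubmodule.subset_lieSpan (Set.mem_singleton _)⟩ =
          WInfinity.Irr.hwVec (WInfinity.Winf.grading n) lam ∧
        ∀ (j : ℤ) (x : LieSubmodule.lieSpan ℂ (WInfinity.Winf n)
            {WInfinity.Irr.hwVec WInfinity.W1.grading lamt}),
          (x : WInfinity.Irr WInfinity.W1.grading lamt) ∈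
              WInfinity.Irr.grading WInfinity.W1.grading lamt j →
            f x ∈ WInfinity.Irr.grading (WInfinity.Winf.grading n) lam j := by
  open WInfinity in
  obtain ⟨lamt, hres⟩ := Winf.exists_extension lam
  refine ⟨lamt, hres, Winf.isQuasifinite_extension hres hlam, ?_⟩
  have hv := Irr.isHighestWeight (𝒢 := W1.grading) (lam := lamt)
  obtain ⟨φ, hφ⟩ := (Winf.isHighestWeight_of_restrict hres hv).exists_hom
  have heig := Winf.hom_mem_eigenspace hv φ hφ
  -- The eigenvalues of D make the kernel graded, and v ≠ 0 in L(lamt) makes it proper.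
  have hker : φ.ker ≤ Verma.maxGraded (Winf.grading n) lam := by
    refine le_sSup ⟨Verma.isGraded_of_ker (Winf.isLieGrading n) (φ := (φ : Verma (Winf.grading n) lam →ₗ[ℂ] Irr W1.grading lamt)) heig
      fun m => LieModuleHom.mem_ker (f := φ), fun h => W1.irr_hwVec_ne_zero lamt ?_⟩
    rw [← hφ]
    exact LieModuleHom.mem_ker.1 (h ▸ LieSubmodule.mem_top _)
  have hrange : ∀ x ∈ LieSubmodule.lieSpan ℂ (Winf n) {Irr.hwVec W1.grading lamt},
      ∃ m, φ m = x := by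
    intro x hx
    have hle : LieSubmodule.lieSpan ℂ (Winf n) {Irr.hwVec W1.grading lamt} ≤ φ.range :=
      LieSubmodule.lieSpan_le.2 (Set.singleton_subset_iff.2 ((LieModuleHom.mem_range _ _).2 ⟨_, hφ⟩))
    exact (LieModuleHom.mem_range _ _).1 (hle hx)
  obtain ⟨f, hf⟩ := exists_factor φ
    (LieSubmodule.Quotient.mk' (Verma.maxGraded (Winf.grading n) lam))
    (fun m hm => (LieSubmodule.Quotient.mk_eq_zero _).2 (hker (LieModuleHom.mem_ker.2 hm))) _ hrange
  refine ⟨f, fun y => ?_, hf _ _ hφ, fun j x hx => ?_⟩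
  · obtain ⟨m, rfl⟩ := LieSubmodule.Quotient.surjective_mk' _ y
    have hm : φ m ∈ LieSubmodule.lieSpan ℂ (Winf n) {Irr.hwVec W1.grading lamt} := by
      obtain ⟨u, rfl⟩ := Verma.proj_surjective m
      rw [Verma.proj_eq_orbit, map_orbit, hφ]
      exact orbit_mem _ (LieSubmodule.subset_lieSpan (Set.mem_singleton _)) u
    exact ⟨⟨_, hm⟩, hf _ m rfl⟩
  · obtain ⟨m, hm⟩ := hrange x x.2
    obtain ⟨m', hm', rfl⟩ := (Submodule.mem_iSup_iff_exists_finsupp _ _).1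
      ((Winf.isLieGrading n).iSup_grading (lam := lam) ▸ Submodule.mem_top (x := m))
    -- As x lies in the eigenspace for degree j, the other components of its preimage die. The
    -- component `m' j` alone is then a preimage of x, homogeneous of degree j.
    have h0 : ∀ i ≠ j, φ (m' i) = 0 := fun i hi =>
      map_component_eq_zero (φ := (φ : Verma (Winf.grading n) lam →ₗ[ℂ] Irr W1.grading lamt)) heig hm' (k := j)
        (W1.irr_grading_le (hm.symm ▸ hx)) hi
    rw [hf x (m' j) ?_]
    · exact ⟨m' j, hm' j, rfl⟩
    · rw [← hm, Finsupp.sum, map_sum]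
      by_cases hj : j ∈ m'.support
      · rw [Finset.sum_eq_single_of_mem j hj fun i _ hi => h0 i hi]
      · rw [Finsupp.notMem_support_iff.1 hj, map_zero, Finset.sum_eq_zero]
        intro i hi
        exact h0 i fun h => hj (h ▸ hi)
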